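/- **Theorem 5 (convergence of the dual fixed-point iteration, scalar case).** Consider the system $x_{t+1}=Ax_t+B_uu_t+B_ww_t$ with scalar state and scalar disturbance ($d_x=d_w=1$; $A,B_w\in\mathbb R$), $u_t\in\mathbb R^{d_u}$, real $B_u$, stage cost $|x_t|^2+\|u_t\|^2$, and $(A,B_u)$, $(A,B_w)$ stabilizable. On $z=e^{j\omega}$ put $F(z)=(z-A)^{-1}B_u$, $G(z)=(z-A)^{-1}B_w$, and for a controller $K$ put $T_K=\begin{bmatrix}FK+G\\K\end{bmatrix}$. Call $K$ admissible if $K$ and $FK+G$ are in $H_\infty$ (bounded and causal), and let $\gamma_\infty=\inf\{\|T_K\|_\infty: K\text{ admissible}\}$. Let $K_\circ=-(I+F^*F)^{-1}F^*G$, and let $\Delta$ be the causal and causally invertible spectral factor $\Delta^*\Delta=I+F^*F$ (for a plant with $|A|\ge1$: $\Delta^{-1}$ is the denominator of the normalized right coprime factorization of $F$ over $H_\infty$). For a spectrum $N>0$ let $L$ be its spectral factor: $|L|^2=N$, $L$ causal and causally invertible, $L(\infty)>0$. Let $P>0$ be the stabilizing solution of $P=1+A^2P-A^2P^2B_u(I+B_u^\top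 PB_u)^{-1}B_u^\top$, and put $$\overline A=A-B_u(I+B_u^\top PB_u)^{-1}B_u^\top PA,\quad \overline C=-(I+B_u^\top PB_u)^{-1/2}B_u^\top,\quad \overline D=\overline A\,P\,B_w .$$ Let $\gamma>\gamma_\infty$. Start from $\overline B^{(0)}=0$ and iterate, for $n\ge0$, $$S^{(n)}(e^{j\omega})=\overline C(e^{-j\omega}-\overline A)^{-1}\overline B^{(n)},\qquad N^{(n)}(e^{j\omega})=\max\Big\{\frac{S^{(n)}(e^{j\omega})^*S^{(n)}(e^{j\omega})}{\gamma^2-T_{K_\circ}(e^{j\omega})^*T_{K_\circ}(e^{j\omega})},\,1\Big\},$$ $$L^{(n+1)}=\text{the spectral factor of }N^{(n)},\qquad \overline B^{(n+1)}=\frac1{2\pi}\int_0^{2\pi}(1-e^{j\omega}\overline A)^{-1}\,\overline D\,L^{(n+1)}(e^{j\omega})\,d\omega .$$ Then the spectral factors $L^{(n+1)}$ exist; for every $\omega$ the sequence $N^{(n)}(e^{j\omega})$ is non-decreasing in $n$; and $N^{(n)}$ converges, uniformly in $\omega$, to a spectrum $N_\gamma$ which, up to null sets, is the unique solution of the scalar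 KKT condition $$N_\gamma=L_\gamma^*L_\gamma=\max\Big\{\frac{\{\Delta K_\circ L_\gamma\}_-^*\{\Delta K_\circ L_\gamma\}_-}{\gamma^2-T_{K_\circ}^*T_{K_\circ}},\,1\Big\},\qquad L_\gamma \text{ the spectral factor of } N_\gamma,\quad \Delta K_\gamma L_\gamma=\{\Delta K_\circ L_\gamma\}_+ ,$$ with an admissible controller $K_\gamma$. Here $\{\cdot\}_+$ and $\{\cdot\}_-$ are the causal and the strictly anticausal part. This solution is optimal: $(K_\gamma,\,N_\gamma-1)$ is a saddle point of $$\max_{\Lambda\in L_1,\ \Lambda\ge0}\ \min_{K\text{ admissible}}\ \frac1{2\pi}\int_0^{2\pi}T_K^*T_K\,(1+\Lambda)\,d\omega-\frac{\gamma^2}{2\pi}\int_0^{2\pi}\Lambda\,d\omega .$$ -/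

import Mathlib

open MeasureTheory Filter Topology
open scoped Real ENNReal MatrixOrder

noncomputable section

namespace MixedControl

/-- The circle of frequencies `ω` modulo `2π`. -/
abbrev Freq : Type := AddCircle (2 * π)

instance : Fact ((0 : ℝ) < 2 * π) := ⟨Real.two_pi_pos⟩

/-- The normalized measure `dω / 2π` on frequencies. -/
abbrev dω : Measure Freq := AddCircle.haarAddCircle

/-- The point `z = e^{jω}` of the unit circle. -/
def ejω (ω : Freq) : ℂ := fourier 1 ω

/-- A transfer function on the unit circle is causal if its Fourier series has only the
powers `e^{-jωt}` with `t ≥ 0`. -/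
def Causal (f : Freq → ℂ) : Prop := ∀ n : ℤ, 0 < n → fourierCoeff f n = 0

/-- Only the powers `e^{jωt}` with `t ≥ 1` occur. -/
def StrictlyAnticausal (f : Freq → ℂ) : Prop := ∀ n : ℤ, n ≤ 0 → fourierCoeff f n = 0

/-- The space `H_∞`: bounded causal transfer functions. -/
def HInf (f : Freq → ℂ) : Prop := MemLp f ∞ dω ∧ Causal f

/-- `L` is the canonical spectral factor of the power spectrum `N`: `|L|² = N`, the factor `L` is
causal and causally invertible, and it is positive at `z = ∞` (this fixes the unimodular
constant). -/
def IsSpectralFactor (N : Freq → ℝ) (L : Freq → ℂ) : Prop :=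
  MemLp L 2 dω ∧ Causal L ∧
  MemLp (fun ω => (L ω)⁻¹) 2 dω ∧ Causal (fun ω => (L ω)⁻¹) ∧
  (∀ᵐ ω ∂dω, ‖L ω‖ ^ 2 = N ω) ∧
  0 < (fourierCoeff L 0).re ∧ (fourierCoeff L 0).im = 0

/-- The canonical spectral factor (the map `F₃`). -/
def spectralFactor (N : Freq → ℝ) : Freq → ℂ := Classical.epsilon (IsSpectralFactor N)

/-- The data of a system `x_{t+1} = a x_t + Bᵤ u_t + b_w w_t` with scalar state, scalar disturbance
and `m` control inputs, with stage cost `|x_t|² + ‖u_t‖²`. -/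
structure Plant (m : ℕ) where
  /-- the state coefficient -/
  a : ℝ
  /-- the input row `Bᵤ` -/
  Bu : Fin m → ℝ
  /-- the disturbance coefficient -/
  bw : ℝ

namespace Plant

variable {m : ℕ} (p : Plant m)

/-- `(A, Bᵤ)` is stabilizable. -/
def StabilizableU : Prop := ∃ k : Fin m → ℝ, |p.a - p.Bu ⬝ᵥ k| < 1

/-- `(A, B_w)` is stabilizable. -/
def StabilizableW : Prop := ∃ k : ℝ, |p.a - p.bw * k| < 1

/-! ### Closed loop -/

/-- `F(e^{jω}) = (e^{jω} - a)⁻¹ Bᵤ`, a row. -/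
def F (ω : Freq) : Fin m → ℂ := fun i => (ejω ω - p.a)⁻¹ * p.Bu i

/-- `G(e^{jω}) = (e^{jω} - a)⁻¹ b_w`. -/
def G (ω : Freq) : ℂ := (ejω ω - p.a)⁻¹ * p.bw

/-- The closed-loop transfer matrix `T_K = [F K + G; K]`, a column of height `1 + m`. -/
def closedLoop (K : Freq → Fin m → ℂ) (ω : Freq) : EuclideanSpace ℂ (Unit ⊕ Fin m) :=
  WithLp.toLp 2 (Sum.elim (fun _ => p.F ω ⬝ᵥ K ω + p.G ω) (K ω))

/-- The causal bounded controllers with a causal bounded closed loop. For `|a| < 1` the second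
condition follows from the first; otherwise it says that the controller stabilizes the system. -/
def Admissible (K : Freq → Fin m → ℂ) : Prop :=
  (∀ i, HInf fun ω => K ω i) ∧ HInf fun ω => p.F ω ⬝ᵥ K ω + p.G ω

/-- `γ_∞`, the least closed-loop `H_∞` norm of an admissible controller. -/
def gammaInf : ℝ≥0∞ :=
  ⨅ (K : Freq → Fin m → ℂ) (_ : p.Admissible K), eLpNorm (p.closedLoop K) ∞ dω

/-- The non-causal controller `K_∘ = -(I + F* F)⁻¹ F* G`. -/
def Knc (ω : Freq) : Fin m → ℂ :=
  -((1 + Matrix.vecMulVec (star (p.F ω)) (p.F ω))⁻¹.mulVec (p.G ω • star (p.F ω)))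

/-- The scalar `T_{K_∘}* T_{K_∘}` at the frequency `ω`. -/
def Tnc (ω : Freq) : ℝ := ‖p.closedLoop p.Knc ω‖ ^ 2

/-! ### The linear-quadratic regulator and the data of the algorithm -/

/-- `R + Bᵤᵀ P Bᵤ` with `R = I`. -/
def lqrWeight (P : ℝ) : Matrix (Fin m) (Fin m) ℝ := 1 + P • Matrix.vecMulVec p.Bu p.Bu

/-- `K_lqr = (R + Bᵤᵀ P Bᵤ)⁻¹ Bᵤᵀ P A`. -/
def lqrGain (P : ℝ) : Fin m → ℝ := (P * p.a) • (p.lqrWeight P)⁻¹.mulVec p.Bu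

/-- `P` is the positive stabilizing solution of the Riccati equation with `Q = 1`, `R = I`. -/
def IsRiccati (P : ℝ) : Prop :=
  0 < P ∧
  P = 1 + p.a * P * p.a
    - p.a * P * (p.Bu ⬝ᵥ (p.lqrWeight P)⁻¹.mulVec p.Bu) * P * p.a ∧
  |p.a - p.Bu ⬝ᵥ p.lqrGain P| < 1

/-- The positive stabilizing solution of the Riccati equation. -/
def P : ℝ := Classical.epsilon p.IsRiccati

/-- `Ā = (A - Bᵤ K_lqr)ᵀ`. -/
def Abar : ℝ := p.a - p.Bu ⬝ᵥ p.lqrGain p.P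

/-- `C̄ = -(R + Bᵤᵀ P Bᵤ)^{-T/2} Bᵤᵀ`. -/
def Cbar : Fin m → ℝ := -((CFC.sqrt (p.lqrWeight p.P))⁻¹.transpose.mulVec p.Bu)

/-- `D̄ = (A - Bᵤ K_lqr)ᵀ P B_w`. -/
def Dbar : ℝ := p.Abar * p.P * p.bw

/-! ### The algorithm -/

/-- `F₁ : B̄ ↦ S₋(e^{jω}) = C̄ (e^{-jω} - Ā)⁻¹ B̄`. -/
def F1 (B : ℂ) (ω : Freq) : Fin m → ℂ :=
  fun i => p.Cbar i * ((ejω ω)⁻¹ - p.Abar)⁻¹ * B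

/-- `F₂ : S ↦ max {S* S / (γ² - T_{K_∘}* T_{K_∘}), 1}`. -/
def F2 (γ : ℝ) (S : Freq → Fin m → ℂ) (ω : Freq) : ℝ :=
  max ((∑ i, ‖S ω i‖ ^ 2) / (γ ^ 2 - p.Tnc ω)) 1

/-- `F₄ : L ↦ B̄ = (1/2π) ∫ (1 - e^{jω} Ā)⁻¹ D̄ L(e^{jω}) dω`. -/
def F4 (L : Freq → ℂ) : ℂ := ∫ ω, (1 - ejω ω * p.Abar)⁻¹ * p.Dbar * L ω ∂dω

/-- The parameters `B̄⁽ⁿ⁾` of the iteration started at `B̄⁽⁰⁾ = 0`. -/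
def Biter (γ : ℝ) : ℕ → ℂ
  | 0 => 0
  | n + 1 => p.F4 (spectralFactor (p.F2 γ (p.F1 (Biter γ n))))

/-- The spectra `N⁽ⁿ⁾ = F₂ (F₁ B̄⁽ⁿ⁾)` of the iteration. -/
def Niter (γ : ℝ) (n : ℕ) : Freq → ℝ := p.F2 γ (p.F1 (p.Biter γ n))

/-! ### Optimality -/

/-- `Δ` is a spectral factor of `I + F* F`, that is `Δ* Δ = I + F* F`, which is causal and causally
invertible. The conditions are written so that they make sense also for an unstable plant: `Δ⁻¹` and
`F Δ⁻¹` are in `H_∞`, and `Δ = X + Y F` with `X`, `Y` in `H_∞` (a normalized coprime factorization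
of `F`). For `|a| < 1` the function `F` is itself in `H_∞`, and the conditions say exactly that
`Δ` and `Δ⁻¹` are in `H_∞`. -/
def IsPlantFactor (Δ : Freq → Matrix (Fin m) (Fin m) ℂ) : Prop :=
  (∀ᵐ ω ∂dω, (Δ ω).conjTranspose * Δ ω = 1 + Matrix.vecMulVec (star (p.F ω)) (p.F ω)) ∧
  (∀ i j, HInf fun ω => (Δ ω)⁻¹ i j) ∧
  (∀ j, HInf fun ω => Matrix.vecMul (p.F ω) (Δ ω)⁻¹ j) ∧
  ∃ (X : Freq → Matrix (Fin m) (Fin m) ℂ) (Y : Freq → Fin m → ℂ),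
    (∀ i j, HInf fun ω => X ω i j) ∧ (∀ i, HInf fun ω => Y ω i) ∧
    ∀ᵐ ω ∂dω, Δ ω = X ω + Matrix.vecMulVec (Y ω) (p.F ω)

/-- The scalar KKT condition for the spectrum `N = L* L`, with its controller `K`:
`N = max {S* S / (γ² - T_{K_∘}* T_{K_∘}), 1}` with `S = {Δ K_∘ L}₋` and `Δ K L = {Δ K_∘ L}₊`.
The last two equations are expressed as the splitting `Δ K_∘ L = Δ K L + S` into a causal part,
given by an admissible `K`, and a strictly anticausal part `S`. -/
def IsKKT (γ : ℝ) (N : Freq → ℝ) (K : Freq → Fin m → ℂ) : Prop :=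
  ∃ (Δ : Freq → Matrix (Fin m) (Fin m) ℂ) (L : Freq → ℂ) (S : Freq → Fin m → ℂ),
    p.IsPlantFactor Δ ∧ IsSpectralFactor N L ∧ p.Admissible K ∧
    (∀ i, MemLp (fun ω => S ω i) 2 dω ∧ StrictlyAnticausal fun ω => S ω i) ∧
    (∀ᵐ ω ∂dω, L ω • (Δ ω).mulVec (p.Knc ω) = L ω • (Δ ω).mulVec (K ω) + S ω) ∧
    ∀ᵐ ω ∂dω, N ω = max ((∑ i, ‖S ω i‖ ^ 2) / (γ ^ 2 - p.Tnc ω)) 1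

/-- The Lagrangian `tr (T_K* T_K (I + Λ)) - γ² tr Λ`. -/
def lagrangian (γ : ℝ) (K : Freq → Fin m → ℂ) (Λ : Freq → ℝ) : ℝ :=
  ∫ ω, ‖p.closedLoop K ω‖ ^ 2 * (1 + Λ ω) ∂dω - γ ^ 2 * ∫ ω, Λ ω ∂dω

/-- `Λ` is an admissible dual variable: integrable and nonnegative. -/
def DualFeasible (Λ : Freq → ℝ) : Prop := Integrable Λ dω ∧ ∀ᵐ ω ∂dω, 0 ≤ Λ ω

/-- `(K, Λ)` is a saddle point of the max-min problem
`max_{Λ ≥ 0} min_K tr (T_K* T_K (I + Λ)) - γ² tr Λ`. -/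
def IsSaddlePoint (γ : ℝ) (K : Freq → Fin m → ℂ) (Λ : Freq → ℝ) : Prop :=
  p.Admissible K ∧ DualFeasible Λ ∧
  (∀ K', p.Admissible K' → p.lagrangian γ K Λ ≤ p.lagrangian γ K' Λ) ∧
  ∀ Λ', DualFeasible Λ' → p.lagrangian γ K Λ' ≤ p.lagrangian γ K Λ

end Plant

end MixedControl

end

noncomputable section

namespace MixedControl

open scoped ComplexConjugate InnerProductSpace

/-! ### The exponential on the circle of frequencies -/

/-! Since the state is scalar, the strictly anticausal part of an iterate depends on its parameter
only through a factor of modulus `|B̄|`, so everything reduces to one real number `s = |B̄|²`. The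
spectra form the one-parameter family `spectrumOf γ s = max (s * weight, 1)`, and the iteration
becomes `s ↦ dualMap γ s = D̄² |L_s(Ā)|²`, where `L_s` is the spectral factor of `spectrumOf γ s`
and `L_s(Ā)` is its value at `z⁻¹ = Ā`, a point inside the disc.

Spectral factors are compared by the maximum principle. If `N₁ ≤ N₂`, then `L₁ / L₂` is causal and
bounded by one, so `|L₁(Ā)| ≤ |L₂(Ā)|`, with equality only for `N₁ = N₂` almost everywhere. Hence
the dual map is monotone, and it is subhomogeneous because `spectrumOf γ (t s) ≤ t spectrumOf γ s`
for `t ≥ 1`.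

The assumption `γ > γ_∞` enters through `dualMap_lt`: a controller feasible with a margin forces
`dualMap γ s < s` whenever the constraint is active at all frequencies. This bounds the iteration
from above (`exists_dualMap_le`), so it increases to a limit, and subhomogeneity, in place of
continuity, makes the limit a fixed point (`tendsto_iterate_of_subhomogeneous`). It also gives
uniqueness: two fixed points `0 < s < t` produce equality in the maximum principle, so `N_t = (t/s)
N_s > 1` almost everywhere, and then `dualMap γ t < t`.

Fixed points correspond to KKT spectra. With `Δ` the normalized plant factor, the admissible
controllers are exactly those for which `Δ (K_∘ - K)` is a fixed anticausal term with its pole given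
by `Ā`, plus an arbitrary `H_∞` vector (`exists_param_of_admissible`, `exists_admissible_of_param`).
Multiplication by `L` and removal of the causal part leaves that anticausal kernel times `L(Ā)`
(`ae_eq_of_kernel_splitting`). Finally, completing the square gives `‖T_K‖² = ‖Δ (K_∘ - K)‖² +
T_{K_∘}* T_{K_∘}`; orthogonality of causal and strictly anticausal functions, together with
complementary slackness, gives the saddle point.

Existence of the spectral factors is proved by Szegő's prediction argument
(`exists_isSpectralFactor`). -/

@[fun_prop]
lemma continuous_ejω : Continuous ejω := (fourier 1).continuous

@[simp]
lemma norm_ejω (ω : Freq) : ‖ejω ω‖ = 1 := by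
  rw [ejω, fourier_one]
  exact Circle.norm_coe _

@[simp]
lemma ejω_ne_zero (ω : Freq) : ejω ω ≠ 0 := by
  intro h
  simpa [h] using norm_ejω ω

lemma conj_ejω (ω : Freq) : conj (ejω ω) = (ejω ω)⁻¹ := by
  rw [Complex.inv_def, Complex.normSq_eq_norm_sq, norm_ejω]
  simp

lemma ejω_injective : Function.Injective ejω := by
  intro x y h
  simp only [ejω, fourier_one] at h
  exact AddCircle.injective_toCircle Real.two_pi_pos.ne' (Subtype.ext h)

lemma fourier_eq_zpow (n : ℤ) (ω : Freq) : (fourier n ω : ℂ) = ejω ω ^ n := by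
  rw [fourier_apply, AddCircle.toCircle_zsmul, ejω, fourier_one]
  simp

lemma fourierCoeff_eq (f : Freq → ℂ) (n : ℤ) :
    fourierCoeff f n = ∫ ω, ejω ω ^ (-n) * f ω ∂dω := by
  simp only [fourierCoeff, fourier_eq_zpow, smul_eq_mul]

lemma fourierCoeff_ejω_mul (f : Freq → ℂ) (n : ℤ) :
    fourierCoeff (fun ω => ejω ω * f ω) n = fourierCoeff f (n - 1) := by
  simp only [fourierCoeff_eq]
  congr 1 with ω
  rw [show -(n - 1) = -n + 1 by ring, zpow_add_one₀ (ejω_ne_zero ω), mul_assoc]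

lemma fourierCoeff_inv_ejω_mul (f : Freq → ℂ) (n : ℤ) :
    fourierCoeff (fun ω => (ejω ω)⁻¹ * f ω) n = fourierCoeff f (n + 1) := by
  rw [← add_sub_cancel_right n 1, ← fourierCoeff_ejω_mul]
  simp

lemma fourierCoeff_conj (f : Freq → ℂ) (n : ℤ) :
    fourierCoeff (fun ω => conj (f ω)) n = conj (fourierCoeff f (-n)) := by
  simp only [fourierCoeff_eq]
  rw [← integral_conj]
  congr 1 with ω
  simp [map_zpow₀, conj_ejω]

lemma fourierCoeff_const (k : ℂ) (n : ℤ) :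
    fourierCoeff (fun _ : Freq => k) n = if n = 0 then k else 0 := by
  have h := fourierCoeff.const_mul (T := 2 * π) (fun ω => (fourier 0 ω : ℂ)) k n
  have h2 := fourierCoeff_fourier (T := 2 * π) 0
  rw [h2] at h
  simp only [fourier_zero, mul_one] at h
  rw [h]
  by_cases hn : n = 0
  · subst hn; simp
  · simp [hn]

lemma measure_ejω_eq (x : ℂ) : dω {ω | ejω ω = x} = 0 := by
  have hs : {ω | ejω ω = x}.Subsingleton := fun u hu v hv => ejω_injective (hu.trans hv.symm)
  have hv : volume {ω : Freq | ejω ω = x} = 0 := by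
    rcases hs.eq_empty_or_singleton with h | ⟨u, h⟩
    · simp [h]
    · rw [h, ← Metric.closedBall_zero, AddCircle.volume_closedBall]
      simp [Real.pi_pos.le]
  rw [AddCircle.volume_eq_smul_haarAddCircle] at hv
  simpa [Real.pi_pos.not_ge] using hv

/-- For `|a| = 1` the plant has its pole on the circle. Identities that divide by `z - a` are used
off this null set. -/
lemma ae_ejω_ne (x : ℂ) : ∀ᵐ ω ∂dω, ejω ω ≠ x := by
  rw [ae_iff]
  simpa using measure_ejω_eq x

/-! ### Causal functions -/

lemma Causal.congr {f g : Freq → ℂ} (hf : Causal f) (h : f =ᵐ[dω] g) : Causal g := by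
  intro n hn
  rw [← fourierCoeff_congr_ae h]
  exact hf n hn

lemma fourierCoeff_fun_add {f g : Freq → ℂ} (hf : Integrable f dω) (hg : Integrable g dω)
    (n : ℤ) : fourierCoeff (fun ω => f ω + g ω) n = fourierCoeff f n + fourierCoeff g n :=
  congrFun (fourierCoeff.add hf hg) n

lemma Causal.add {f g : Freq → ℂ} (hf : Causal f) (hg : Causal g) (hfi : Integrable f dω)
    (hgi : Integrable g dω) : Causal fun ω => f ω + g ω := by
  intro n hn
  rw [fourierCoeff_fun_add hfi hgi, hf n hn, hg n hn, add_zero]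

lemma Causal.const_mul {f : Freq → ℂ} (hf : Causal f) (k : ℂ) : Causal fun ω => k * f ω := by
  intro n hn
  rw [fourierCoeff.const_mul, hf n hn, mul_zero]

lemma causal_const (k : ℂ) : Causal fun _ => k := by
  intro n hn
  rw [fourierCoeff_const, if_neg hn.ne']

lemma Causal.sub {f g : Freq → ℂ} (hf : Causal f) (hg : Causal g) (hfi : Integrable f dω)
    (hgi : Integrable g dω) : Causal fun ω => f ω - g ω := by
  have := hf.add (hg.const_mul (-1)) hfi (hgi.const_mul (-1))
  simpa [sub_eq_add_neg] using this

lemma Causal.sum {ι : Type*} (s : Finset ι) {f : ι → Freq → ℂ} (hf : ∀ i ∈ s, Causal (f i))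
    (hfi : ∀ i ∈ s, Integrable (f i) dω) : Causal fun ω => ∑ i ∈ s, f i ω := by
  intro n hn
  have := congrFun (fourierCoeff.sum s f hfi) n
  rw [Finset.sum_apply] at this
  rw [show (fun ω => ∑ i ∈ s, f i ω) = ∑ i ∈ s, f i by ext; simp, this]
  exact Finset.sum_eq_zero fun i hi => hf i hi n hn

lemma Causal.inv_ejω_mul {f : Freq → ℂ} (hf : Causal f) : Causal fun ω => (ejω ω)⁻¹ * f ω := by
  intro n hn
  rw [fourierCoeff_inv_ejω_mul]
  exact hf _ (by omega)

/-- Parseval: the Fourier coefficients of a product of square integrable functions. -/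
lemma hasSum_fourierCoeff_mul {f g : Freq → ℂ} (hf : MemLp f 2 dω) (hg : MemLp g 2 dω) (n : ℤ) :
    HasSum (fun k => fourierCoeff f (n - k) * fourierCoeff g k)
      (fourierCoeff (fun ω => f ω * g ω) n) := by
  -- The `n`-th coefficient of `f g` is the inner product of `zⁿ f̄` with `g`, the inner product
  -- being conjugate-linear in its first argument.
  have hu : MemLp (fun ω => ejω ω ^ n * conj (f ω)) 2 dω := by
    refine MemLp.of_le (g := f) hf ?_ ?_
    · refine AEStronglyMeasurable.mul ?_ ?_
      · have : (fun ω => ejω ω ^ n) = fun ω => (fourier n ω : ℂ) := by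
          ext ω; rw [fourier_eq_zpow]
        rw [this]
        exact (fourier n).continuous.aestronglyMeasurable
      · exact Complex.continuous_conj.comp_aestronglyMeasurable hf.1
    · exact .of_forall fun ω => by simp
  have key := fourierBasis.hasSum_inner_mul_inner (𝕜 := ℂ) hu.toLp hg.toLp
  have hrep : ∀ (v : Freq → ℂ) (hv : MemLp v 2 dω) (k : ℤ),
      inner ℂ (fourierBasis (T := 2 * π) k) (hv.toLp) = fourierCoeff v k := by
    intro v hv k
    rw [← HilbertBasis.repr_apply_apply, fourierBasis_repr]
    rw [fourierCoeff_congr_ae hv.coeFn_toLp]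
  have e1 : (fun k => fourierCoeff f (n - k) * fourierCoeff g k) = fun k =>
      inner ℂ hu.toLp (fourierBasis (T := 2 * π) k) * inner ℂ (fourierBasis k) hg.toLp := by
    funext k
    rw [hrep g hg, ← inner_conj_symm, hrep _ hu]
    congr 1
    simp only [fourierCoeff_eq]
    rw [← integral_conj]
    congr 1 with ω
    simp only [map_mul, map_zpow₀, conj_ejω, Complex.conj_conj, ← mul_assoc, inv_zpow']
    rw [← zpow_add₀ (ejω_ne_zero ω)]
    congr 2
    ring
  have e2 : fourierCoeff (fun ω => f ω * g ω) n = inner ℂ hu.toLp hg.toLp := by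
    rw [L2.inner_def, fourierCoeff_eq]
    refine integral_congr_ae ?_
    filter_upwards [hu.coeFn_toLp, hg.coeFn_toLp] with ω h1 h2
    rw [h1, h2]
    simp only [RCLike.inner_apply, map_mul, map_zpow₀, conj_ejω, Complex.conj_conj, inv_zpow']
    ring
  rw [e1, e2]
  exact key

lemma Causal.mul {f g : Freq → ℂ} (hf : Causal f) (hg : Causal g) (hf2 : MemLp f 2 dω)
    (hg2 : MemLp g 2 dω) : Causal fun ω => f ω * g ω := by
  intro n hn
  refine (hasSum_fourierCoeff_mul hf2 hg2 n).unique ?_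
  convert hasSum_zero with k
  rcases lt_or_ge 0 k with hk | hk
  · rw [hg k hk, mul_zero]
  · rw [hf _ (by omega), zero_mul]

lemma fourierCoeff_zero_mul {f g : Freq → ℂ} (hf : Causal f) (hg : Causal g)
    (hf2 : MemLp f 2 dω) (hg2 : MemLp g 2 dω) :
    fourierCoeff (fun ω => f ω * g ω) 0 = fourierCoeff f 0 * fourierCoeff g 0 := by
  refine (hasSum_fourierCoeff_mul hf2 hg2 0).unique ?_
  rw [show fourierCoeff f 0 * fourierCoeff g 0 = fourierCoeff f (0 - 0) * fourierCoeff g 0 by simp]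
  refine hasSum_single (0 : ℤ) fun k hk => ?_
  rcases lt_or_gt_of_ne hk with hk | hk
  · rw [hf _ (by omega), zero_mul]
  · rw [hg k hk, mul_zero]

/-- The two Fourier supports are disjoint. This orthogonality removes the cross term in the
minimization over controllers. -/
lemma integral_conj_mul_eq_zero {f g : Freq → ℂ} (hf : StrictlyAnticausal f) (hg : Causal g)
    (hf2 : MemLp f 2 dω) (hg2 : MemLp g 2 dω) : ∫ ω, conj (f ω) * g ω ∂dω = 0 := by
  have hf2' : MemLp (fun ω => conj (f ω)) 2 dω := hf2.star
  have h := (hasSum_fourierCoeff_mul hf2' hg2 0).unique (a₂ := 0) (by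
    convert hasSum_zero with k
    rcases lt_or_ge 0 k with hk | hk
    · rw [hg k hk, mul_zero]
    · rw [fourierCoeff_conj, hf _ (by omega), map_zero, zero_mul])
  simpa [fourierCoeff_eq] using h

lemma ae_eq_zero_of_fourierCoeff {f : Freq → ℂ} (hf : MemLp f 2 dω)
    (h : ∀ n, fourierCoeff f n = 0) : f =ᵐ[dω] 0 := by
  have h0 : hf.toLp = 0 := by
    apply fourierBasis.repr.injective
    ext n
    rw [fourierBasis_repr, fourierCoeff_congr_ae hf.coeFn_toLp, h]
    simp
  exact hf.coeFn_toLp.symm.trans (h0 ▸ Lp.coeFn_zero _ _ _)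

lemma ae_eq_zero_of_causal_of_strictlyAnticausal {f : Freq → ℂ} (hf : MemLp f 2 dω)
    (h : Causal f) (h' : StrictlyAnticausal f) : f =ᵐ[dω] 0 :=
  ae_eq_zero_of_fourierCoeff hf fun n => by
    rcases lt_or_ge 0 n with hn | hn
    exacts [h n hn, h' n hn]

/-- A causal function with causal complex conjugate is constant. -/
lemma ae_eq_const_of_causal_conj {f : Freq → ℂ} (hf : MemLp f 2 dω)
    (h : Causal f) (h' : Causal fun ω => conj (f ω)) : ∃ k, ∀ᵐ ω ∂dω, f ω = k := by
  refine ⟨fourierCoeff f 0, ?_⟩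
  have hi : Integrable f dω := hf.integrable one_le_two
  have := ae_eq_zero_of_fourierCoeff (f := fun ω => f ω + -fourierCoeff f 0)
      (hf.add (memLp_const _)) fun n => by
    rw [fourierCoeff_fun_add hi (integrable_const _), fourierCoeff_const]
    rcases lt_trichotomy n 0 with hn | hn | hn
    · have := h' (-n) (by omega)
      rw [fourierCoeff_conj, neg_neg] at this
      rw [(map_eq_zero _).1 this]
      simp [hn.ne]
    · subst hn; simp
    · simp [h n hn, hn.ne']
  filter_upwards [this] with ω hω
  simpa [← sub_eq_add_neg, sub_eq_zero] using hω

/-! ### Evaluation of causal functions inside the disc `|z⁻¹| < 1` -/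

lemma memLp_of_continuous {E : Type*} [NormedAddCommGroup E] {f : Freq → E} (hf : Continuous f)
    (q : ℝ≥0∞) : MemLp f q dω :=
  hf.memLp_of_hasCompactSupport (HasCompactSupport.of_compactSpace f)

/-- Evaluation of a causal function at `z⁻¹ = c`, by Cauchy's formula. -/
def evalAt (c : ℝ) (f : Freq → ℂ) : ℂ := ∫ ω, (1 - ejω ω * c)⁻¹ * f ω ∂dω

section

variable {c : ℝ}

lemma ejω_sub_ne_zero (hc : |c| < 1) (ω : Freq) : ejω ω - c ≠ 0 := by
  intro h
  have := norm_ejω ω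
  rw [sub_eq_zero.1 h, Complex.norm_real, Real.norm_eq_abs] at this
  linarith

lemma inv_ejω_sub_ne_zero (hc : |c| < 1) (ω : Freq) : (ejω ω)⁻¹ - c ≠ 0 := by
  have h := (map_ne_zero (starRingEnd ℂ)).2 (ejω_sub_ne_zero hc ω)
  rwa [map_sub, conj_ejω, Complex.conj_ofReal] at h

lemma one_sub_ejω_mul_ne_zero (hc : |c| < 1) (ω : Freq) : 1 - ejω ω * c ≠ 0 := by
  have h := mul_ne_zero (ejω_ne_zero ω) (inv_ejω_sub_ne_zero hc ω)
  rwa [mul_sub, mul_inv_cancel₀ (ejω_ne_zero ω)] at h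

lemma inv_ejω_sub_eq (ω : Freq) : (ejω ω)⁻¹ - c = (1 - ejω ω * c) * (ejω ω)⁻¹ := by
  have := ejω_ne_zero ω
  field_simp

lemma continuous_inv_ejω : Continuous fun ω => (ejω ω)⁻¹ :=
  continuous_ejω.inv₀ ejω_ne_zero

lemma continuous_anticausal_kernel (hc : |c| < 1) : Continuous fun ω => ((ejω ω)⁻¹ - c)⁻¹ :=
  (continuous_inv_ejω.sub continuous_const).inv₀ (inv_ejω_sub_ne_zero hc)

lemma continuous_causal_kernel (hc : |c| < 1) : Continuous fun ω => (ejω ω - c)⁻¹ :=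
  (continuous_ejω.sub continuous_const).inv₀ (ejω_sub_ne_zero hc)

lemma continuous_cauchy_kernel (hc : |c| < 1) : Continuous fun ω => (1 - ejω ω * c)⁻¹ :=
  (continuous_const.sub (continuous_ejω.mul continuous_const)).inv₀ (one_sub_ejω_mul_ne_zero hc)

lemma norm_inv_ejω_sub (ω : Freq) : ‖(ejω ω)⁻¹ - c‖ = ‖ejω ω - c‖ := by
  rw [← Complex.norm_conj, map_sub, map_inv₀, conj_ejω, inv_inv, Complex.conj_ofReal]

lemma norm_fourierCoeff_le (f : Freq → ℂ) (n : ℤ) : ‖fourierCoeff f n‖ ≤ ∫ ω, ‖f ω‖ ∂dω := by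
  rw [fourierCoeff_eq]
  refine (norm_integral_le_integral_norm _).trans (le_of_eq ?_)
  simp

lemma integrable_continuous_mul {f g : Freq → ℂ} (hg : Continuous g) (hf : Integrable f dω) :
    Integrable (fun ω => g ω * f ω) dω :=
  hf.mul_of_top_right (memLp_of_continuous hg ∞)

lemma memLp_continuous_mul {f g : Freq → ℂ} {q : ℝ≥0∞} (hg : Continuous g) (hf : MemLp f q dω) :
    MemLp (fun ω => g ω * f ω) q dω :=
  hf.mul (memLp_of_continuous hg ∞)

lemma fourierCoeff_inv_ejω_sub_mul {q : Freq → ℂ} (hq : Integrable q dω) (n : ℤ) :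
    fourierCoeff (fun ω => ((ejω ω)⁻¹ - c) * q ω) n
      = fourierCoeff q (n + 1) - c * fourierCoeff q n := by
  have h1 := integrable_continuous_mul continuous_inv_ejω hq
  have h2 := hq.const_mul (-c : ℂ)
  have := fourierCoeff_fun_add h1 h2 n
  rw [fourierCoeff_inv_ejω_mul, fourierCoeff.const_mul] at this
  rw [sub_eq_add_neg, ← neg_mul, ← this]
  congr 1
  ext ω
  ring

/-- Multiplying the kernel by `z⁻¹ - c` gives the constant `1`, hence a recursion `k̂(n+1) = c
k̂(n)` for `n < 0`. Run backwards, it bounds a coefficient of index `n ≤ 0` by `|c|^j` times the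
`L¹` norm for every `j`, so that coefficient vanishes. -/
lemma strictlyAnticausal_kernel (hc : |c| < 1) :
    StrictlyAnticausal fun ω => ((ejω ω)⁻¹ - c)⁻¹ := by
  set k : Freq → ℂ := fun ω => ((ejω ω)⁻¹ - c)⁻¹ with hk
  have hki : Integrable k dω := memLp_one_iff_integrable.1
    (memLp_of_continuous (continuous_anticausal_kernel hc) 1)
  have hrec : ∀ n : ℤ, n < 0 → fourierCoeff k (n + 1) = c * fourierCoeff k n := by
    intro n hn
    have h := fourierCoeff_inv_ejω_sub_mul (c := c) hki n
    have h1 : (fun ω => ((ejω ω)⁻¹ - c) * k ω) = fun _ => 1 := by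
      ext ω
      exact mul_inv_cancel₀ (inv_ejω_sub_ne_zero hc ω)
    rw [h1, fourierCoeff_const, if_neg hn.ne] at h
    exact (sub_eq_zero.1 h.symm)
  intro n hn
  have hpow : ∀ j : ℕ, fourierCoeff k n = c ^ j * fourierCoeff k (n - j) := by
    intro j
    induction j with
    | zero => simp
    | succ j ih =>
      rw [ih, pow_succ, mul_assoc, ← hrec _ (by push_cast; omega)]
      congr 2
      push_cast
      ring
  have hle : ∀ j : ℕ, ‖fourierCoeff k n‖ ≤ |c| ^ j * ∫ ω, ‖k ω‖ ∂dω := by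
    intro j
    rw [hpow j, norm_mul, norm_pow, Complex.norm_real, Real.norm_eq_abs]
    exact mul_le_mul_of_nonneg_left (norm_fourierCoeff_le _ _) (by positivity)
  have hlim := (tendsto_pow_atTop_nhds_zero_of_lt_one (abs_nonneg c) hc).mul_const
    (∫ ω, ‖k ω‖ ∂dω)
  rw [zero_mul] at hlim
  exact norm_le_zero_iff.1 (ge_of_tendsto' hlim hle)

lemma fourierCoeff_causal_kernel (hc : |c| < 1) {n : ℤ} (hn : 0 ≤ n) :
    fourierCoeff (fun ω => (ejω ω - c)⁻¹) n = 0 := by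
  have h := fourierCoeff_conj (fun ω => ((ejω ω)⁻¹ - c)⁻¹) n
  rw [strictlyAnticausal_kernel hc _ (by omega), map_zero] at h
  rw [← h]
  congr 1
  ext ω
  rw [map_inv₀, map_sub, map_inv₀, conj_ejω, inv_inv, Complex.conj_ofReal]

lemma causal_kernel (hc : |c| < 1) : Causal fun ω => (ejω ω - c)⁻¹ :=
  fun _ hn => fourierCoeff_causal_kernel hc hn.le

lemma evalAt_congr {f g : Freq → ℂ} (h : f =ᵐ[dω] g) : evalAt c f = evalAt c g :=
  integral_congr_ae (by filter_upwards [h] with ω hω; rw [hω])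

lemma evalAt_const_mul (k : ℂ) (f : Freq → ℂ) :
    evalAt c (fun ω => k * f ω) = k * evalAt c f := by
  simp only [evalAt]
  rw [← integral_const_mul]
  congr 1 with ω
  ring

lemma evalAt_add (hc : |c| < 1) {f g : Freq → ℂ} (hf : Integrable f dω) (hg : Integrable g dω) :
    evalAt c (fun ω => f ω + g ω) = evalAt c f + evalAt c g := by
  simp only [evalAt]
  rw [← integral_add (integrable_continuous_mul (continuous_cauchy_kernel hc) hf)
    (integrable_continuous_mul (continuous_cauchy_kernel hc) hg)]
  congr 1 with ω
  ring

lemma evalAt_const (hc : |c| < 1) (k : ℂ) : evalAt c (fun _ => k) = k := by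
  have h : ∀ ω, (1 - ejω ω * c)⁻¹ * k = k + (c * k) * ((ejω ω)⁻¹ - c)⁻¹ := by
    intro ω
    have h1 := one_sub_ejω_mul_ne_zero hc ω
    have h2 := inv_ejω_sub_eq (c := c) ω
    rw [h2, mul_inv, inv_inv]
    field_simp
    ring
  have hk := strictlyAnticausal_kernel hc 0 le_rfl
  simp only [fourierCoeff_eq, neg_zero, zpow_zero, one_mul] at hk
  simp only [evalAt, h]
  rw [integral_add (integrable_const _) ((memLp_one_iff_integrable.1
    (memLp_of_continuous (continuous_anticausal_kernel hc) 1)).const_mul _), integral_const_mul, hk]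
  simp

/-- The difference quotient of a causal function is causal. -/
lemma Causal.quotient (hc : |c| < 1) {f : Freq → ℂ} (hf : Causal f) (hfi : Integrable f dω) :
    Causal fun ω => ((ejω ω)⁻¹ - c)⁻¹ * (f ω - evalAt c f) := by
  set g : Freq → ℂ := fun ω => f ω - evalAt c f with hg
  set q : Freq → ℂ := fun ω => ((ejω ω)⁻¹ - c)⁻¹ * g ω with hq
  have hgi : Integrable g dω := hfi.sub (integrable_const _)
  have hgc : Causal g := hf.sub (causal_const _) hfi (integrable_const _)
  have hqi : Integrable q dω := integrable_continuous_mul (continuous_anticausal_kernel hc) hgi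
  -- The first coefficient of the quotient is the value of `f - f(c)` at `c`, which is zero; the
  -- recursion below carries this to all higher indices.
  have h1 : fourierCoeff q 1 = 0 := by
    have : evalAt c g = 0 := by
      have := evalAt_add (c := c) hc hfi (integrable_const (-evalAt c f))
      rw [evalAt_const hc, add_neg_cancel] at this
      simpa only [← sub_eq_add_neg] using this
    rw [← this, fourierCoeff_eq, evalAt]
    congr 1 with ω
    have h2 := inv_ejω_sub_eq (c := c) ω
    simp only [hq, h2, mul_inv, inv_inv]
    rw [zpow_neg_one]
    field_simp [ejω_ne_zero ω]
  have hrec : ∀ n : ℕ, fourierCoeff q (n + 1) = 0 := by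
    intro n
    induction n with
    | zero => simpa using h1
    | succ n ih =>
      have h := fourierCoeff_inv_ejω_sub_mul (c := c) hqi ((n + 1 : ℕ) : ℤ)
      have h2 : (fun ω => ((ejω ω)⁻¹ - c) * q ω) = g := by
        ext ω
        rw [hq, mul_inv_cancel_left₀ (inv_ejω_sub_ne_zero hc ω)]
      rw [h2, hgc _ (by omega)] at h
      push_cast at h ⊢
      rw [ih, mul_zero, sub_zero] at h
      exact h.symm
  intro n hn
  have := hrec (n - 1).toNat
  rwa [Int.toNat_of_nonneg (by omega), sub_add_cancel] at this

/-- The Cauchy kernel times `z⁻¹ - c` is `z⁻¹`, so the integral is the Fourier coefficient of index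
`1`. -/
lemma evalAt_inv_ejω_sub_mul (hc : |c| < 1) {f : Freq → ℂ} (hf : Causal f) :
    evalAt c (fun ω => ((ejω ω)⁻¹ - c) * f ω) = 0 := by
  rw [← hf 1 one_pos, fourierCoeff_eq, evalAt]
  congr 1 with ω
  have h2 := inv_ejω_sub_eq (c := c) ω
  have h1 := one_sub_ejω_mul_ne_zero hc ω
  rw [h2, zpow_neg_one]
  field_simp

/-- Write `f = f(c) + (z⁻¹ - c) q` with `q` causal; the second term, multiplied by `g`, evaluates to
zero. -/
lemma evalAt_mul (hc : |c| < 1) {f g : Freq → ℂ} (hf : Causal f) (hg : Causal g)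
    (hf2 : MemLp f 2 dω) (hg2 : MemLp g 2 dω) :
    evalAt c (fun ω => f ω * g ω) = evalAt c f * evalAt c g := by
  set q : Freq → ℂ := fun ω => ((ejω ω)⁻¹ - c)⁻¹ * (f ω - evalAt c f) with hq
  have hq2 : MemLp q 2 dω :=
    memLp_continuous_mul (continuous_anticausal_kernel hc) (hf2.sub (memLp_const _))
  have hqc : Causal q := hf.quotient hc (hf2.integrable one_le_two)
  have hqg := hqc.mul hg hq2 hg2
  have hqgi : Integrable (fun ω => q ω * g ω) dω := hq2.integrable_mul hg2
  have h1 : (fun ω => f ω * g ω)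
      = fun ω => evalAt c f * g ω + ((ejω ω)⁻¹ - c) * (q ω * g ω) := by
    ext ω
    rw [← mul_assoc, hq, mul_inv_cancel_left₀ (inv_ejω_sub_ne_zero hc ω)]
    ring
  rw [h1, evalAt_add hc ((hg2.integrable one_le_two).const_mul _)
    (integrable_continuous_mul (g := fun ω => (ejω ω)⁻¹ - c)
      (continuous_inv_ejω.sub continuous_const) hqgi), evalAt_const_mul,
    evalAt_inv_ejω_sub_mul hc hqg, add_zero]

/-- The Poisson kernel at `z⁻¹ = c`. -/
def poisson (c : ℝ) (ω : Freq) : ℝ := (1 - c ^ 2) / ‖1 - ejω ω * c‖ ^ 2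

lemma poisson_pos (hc : |c| < 1) (ω : Freq) : 0 < poisson c ω := by
  have := norm_pos_iff.2 (one_sub_ejω_mul_ne_zero hc ω)
  have : c ^ 2 < 1 := (sq_lt_one_iff_abs_lt_one c).2 hc
  unfold poisson
  apply div_pos <;> [linarith; positivity]

lemma continuous_poisson (hc : |c| < 1) : Continuous (poisson c) := by
  unfold poisson
  refine continuous_const.div (by fun_prop) fun ω => ?_
  exact pow_ne_zero _ (norm_ne_zero_iff.2 (one_sub_ejω_mul_ne_zero hc ω))

lemma ofReal_poisson (hc : |c| < 1) (ω : Freq) :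
    (poisson c ω : ℂ) = (1 - ejω ω * c)⁻¹ + c * (ejω ω - c)⁻¹ := by
  have h1 := one_sub_ejω_mul_ne_zero hc ω
  have h2 := ejω_sub_ne_zero hc ω
  have h3 : ((‖1 - ejω ω * c‖ ^ 2 : ℝ) : ℂ) = (1 - ejω ω * c) * ((ejω ω - c) * (ejω ω)⁻¹) := by
    push_cast
    rw [← Complex.mul_conj', map_sub, map_mul, conj_ejω, Complex.conj_ofReal, map_one]
    have := ejω_ne_zero ω
    field_simp
  rw [poisson, Complex.ofReal_div, h3]
  have := ejω_ne_zero ω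
  field_simp
  push_cast
  ring

/-- The Poisson kernel exceeds the Cauchy kernel by the strictly causal `c (z - c)⁻¹`, whose product
with a causal function has mean zero. -/
lemma evalAt_eq_integral_poisson (hc : |c| < 1) {f : Freq → ℂ} (hf : Causal f)
    (hf2 : MemLp f 2 dω) : evalAt c f = ∫ ω, (poisson c ω : ℂ) * f ω ∂dω := by
  have hfi := hf2.integrable one_le_two
  have h0 : ∫ ω, (ejω ω - c)⁻¹ * f ω ∂dω = 0 := by
    have := fourierCoeff_zero_mul (causal_kernel hc) hf
      (memLp_of_continuous (continuous_causal_kernel hc) 2) hf2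
    rw [fourierCoeff_causal_kernel hc le_rfl, zero_mul] at this
    simpa [fourierCoeff_eq] using this
  simp only [ofReal_poisson hc, add_mul, mul_assoc]
  rw [integral_add (integrable_continuous_mul (continuous_cauchy_kernel hc) hfi)
    ((integrable_continuous_mul (continuous_causal_kernel hc) hfi).const_mul _),
    integral_const_mul, h0, mul_zero, add_zero, evalAt]

lemma integral_poisson (hc : |c| < 1) : ∫ ω, poisson c ω ∂dω = 1 := by
  have h := evalAt_eq_integral_poisson hc (causal_const 1) (memLp_const _)
  rw [evalAt_const hc] at h
  simp only [mul_one] at h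
  rw [integral_complex_ofReal] at h
  exact_mod_cast h.symm

lemma integrable_poisson_mul (hc : |c| < 1) {u : Freq → ℝ} (hu : Integrable u dω) :
    Integrable (fun ω => poisson c ω * u ω) dω :=
  hu.mul_of_top_right (memLp_of_continuous (continuous_poisson hc) ∞)

/-- The Poisson kernel is a probability density with mean `f(c)`, so this is nonnegativity of the
variance `∫ poisson * ‖f - f(c)‖²`. -/
lemma sq_norm_evalAt_le (hc : |c| < 1) {f : Freq → ℂ} (hf : Causal f) (hf2 : MemLp f 2 dω) :
    ‖evalAt c f‖ ^ 2 ≤ ∫ ω, poisson c ω * ‖f ω‖ ^ 2 ∂dω := by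
  set e := evalAt c f with he
  have hfi := hf2.integrable one_le_two
  have hi1 : Integrable (fun ω => poisson c ω * ‖f ω‖ ^ 2) dω :=
    integrable_poisson_mul hc (hf2.integrable_norm_pow two_ne_zero)
  have hi2 : Integrable (fun ω => poisson c ω * (conj e * f ω).re) dω :=
    integrable_poisson_mul hc (hfi.const_mul _).re
  have hi3 : Integrable (fun ω => poisson c ω * ‖e‖ ^ 2) dω :=
    integrable_poisson_mul hc (integrable_const _)
  have h2 : ∫ ω, poisson c ω * (conj e * f ω).re ∂dω = ‖e‖ ^ 2 := by
    have h := integral_re (𝕜 := ℂ) (f := fun ω => conj e * ((poisson c ω : ℂ) * f ω)) (μ := dω)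
      ((integrable_continuous_mul
        (Complex.continuous_ofReal.comp (continuous_poisson hc)) hfi).const_mul _)
    rw [integral_const_mul, ← evalAt_eq_integral_poisson hc hf hf2, ← he, Complex.conj_mul'] at h
    rw [← Complex.ofReal_pow] at h
    simp only [RCLike.re_to_complex, Complex.ofReal_re] at h
    rw [← h]
    congr 1 with ω
    rw [mul_left_comm, Complex.re_ofReal_mul]
  have h3 : ∫ ω, poisson c ω * ‖e‖ ^ 2 ∂dω = ‖e‖ ^ 2 := by
    rw [integral_mul_const, integral_poisson hc, one_mul]
  have h0 : 0 ≤ ∫ ω, (poisson c ω * ‖f ω‖ ^ 2 - 2 * (poisson c ω * (conj e * f ω).re)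
      + poisson c ω * ‖e‖ ^ 2) ∂dω := by
    refine integral_nonneg fun ω => ?_
    have h4 : ‖f ω - e‖ ^ 2 = ‖f ω‖ ^ 2 - 2 * (conj e * f ω).re + ‖e‖ ^ 2 := by
      simp only [← Complex.normSq_eq_norm_sq, Complex.normSq_apply, Complex.sub_re,
        Complex.sub_im, Complex.mul_re, Complex.conj_re, Complex.conj_im]
      ring
    have h5 := mul_nonneg (poisson_pos hc ω).le (sq_nonneg ‖f ω - e‖)
    rw [h4] at h5
    simp only [Pi.zero_apply]
    linarith
  have h6 : Integrable (fun ω => poisson c ω * ‖f ω‖ ^ 2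
      - 2 * (poisson c ω * (conj e * f ω).re)) dω := hi1.sub (hi2.const_mul 2)
  rw [integral_add h6 hi3, integral_sub hi1 (hi2.const_mul 2),
    integral_const_mul, h2, h3] at h0
  linarith

lemma norm_evalAt_le_one (hc : |c| < 1) {f : Freq → ℂ} (hf : Causal f) (hf2 : MemLp f 2 dω)
    (h1 : ∀ᵐ ω ∂dω, ‖f ω‖ ≤ 1) : ‖evalAt c f‖ ≤ 1 := by
  have h := sq_norm_evalAt_le hc hf hf2
  have h2 : ∫ ω, poisson c ω * ‖f ω‖ ^ 2 ∂dω ≤ ∫ ω, poisson c ω ∂dω := by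
    refine integral_mono_ae (integrable_poisson_mul hc (hf2.integrable_norm_pow two_ne_zero))
      (memLp_one_iff_integrable.1 (memLp_of_continuous (continuous_poisson hc) 1)) ?_
    filter_upwards [h1] with ω hω
    exact mul_le_of_le_one_right (poisson_pos hc ω).le (pow_le_one₀ (norm_nonneg _) hω)
  rw [integral_poisson hc] at h2
  exact (sq_le_one_iff₀ (norm_nonneg _)).1 (h.trans h2)

/-- The case of equality in the maximum principle. -/
lemma norm_ae_eq_one_of_one_le_norm_evalAt (hc : |c| < 1) {f : Freq → ℂ} (hf : Causal f)
    (hf2 : MemLp f 2 dω) (h1 : ∀ᵐ ω ∂dω, ‖f ω‖ ≤ 1) (h : 1 ≤ ‖evalAt c f‖) :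
    ∀ᵐ ω ∂dω, ‖f ω‖ = 1 := by
  have hP : Integrable (poisson c) dω :=
    memLp_one_iff_integrable.1 (memLp_of_continuous (continuous_poisson hc) 1)
  have hi := integrable_poisson_mul hc (hf2.integrable_norm_pow two_ne_zero)
  have hnn : 0 ≤ᵐ[dω] fun ω => poisson c ω - poisson c ω * ‖f ω‖ ^ 2 := by
    filter_upwards [h1] with ω hω
    exact sub_nonneg.2 <|
      mul_le_of_le_one_right (poisson_pos hc ω).le (pow_le_one₀ (norm_nonneg _) hω)
  have h2 := sq_norm_evalAt_le hc hf hf2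
  have h3 : ∫ ω, (poisson c ω - poisson c ω * ‖f ω‖ ^ 2) ∂dω = 0 := by
    refine le_antisymm ?_ (integral_nonneg_of_ae hnn)
    rw [integral_sub hP hi, integral_poisson hc]
    have := one_le_pow₀ h (n := 2)
    linarith
  filter_upwards [(integral_eq_zero_iff_of_nonneg_ae hnn (hP.sub hi)).1 h3] with ω hω
  have h4 : poisson c ω * (1 - ‖f ω‖ ^ 2) = 0 := by
    simpa [mul_sub] using hω
  have h5 := (mul_eq_zero.1 h4).resolve_left (poisson_pos hc ω).ne'
  have : ‖f ω‖ ^ 2 = 1 := by linarith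
  exact (pow_eq_one_iff_of_nonneg (norm_nonneg _) two_ne_zero).1 this

end

/-! ### Existence of spectral factors -/

/-- Pairing with an `L¹` function is continuous in the uniform norm, and trigonometric polynomials
are dense in the continuous functions. -/
lemma integral_continuousMap_mul_eq_zero {k : Freq → ℂ} (hk : Integrable k dω)
    (h : ∀ n, fourierCoeff k n = 0) (g : C(Freq, ℂ)) : ∫ ω, g ω * k ω ∂dω = 0 := by
  let T : C(Freq, ℂ) →ₗ[ℂ] ℂ :=
    { toFun := fun g => ∫ ω, g ω * k ω ∂dω
      map_add' := fun g g' => by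
        rw [← integral_add (integrable_continuous_mul g.continuous hk)
          (integrable_continuous_mul g'.continuous hk)]
        congr 1 with ω
        simp [add_mul]
      map_smul' := fun a g => by
        rw [RingHom.id_apply, smul_eq_mul, ← integral_const_mul]
        congr 1 with ω
        simp [mul_assoc] }
  let T' := T.mkContinuous (∫ ω, ‖k ω‖ ∂dω) fun g => by
    rw [← integral_mul_const]
    refine norm_integral_le_of_norm_le (hk.norm.mul_const _) (.of_forall fun ω => ?_)
    rw [norm_mul, mul_comm ‖k ω‖]
    exact mul_le_mul_of_nonneg_right (g.norm_coe_le_norm ω) (norm_nonneg _)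
  have hle : Submodule.span ℂ (Set.range (fourier (T := 2 * π))) ≤ LinearMap.ker T'.toLinearMap := by
    rw [Submodule.span_le]
    rintro _ ⟨n, rfl⟩
    have := h (-n)
    rw [fourierCoeff] at this
    simpa [T', T] using this
  have hcl := Submodule.topologicalClosure_minimal _ hle T'.isClosed_ker
  rw [span_fourier_closure_eq_top] at hcl
  exact hcl (Submodule.mem_top : g ∈ ⊤)

/-- The density is only in `L¹`, so Parseval does not apply. Nonnegativity lets `ρ dω` and `C dω` be
compared as finite measures, which agree on continuous functions. -/
lemma ae_eq_of_fourierCoeff_nonneg {ρ : Freq → ℝ} (hρ : Integrable ρ dω) (h0 : ∀ ω, 0 ≤ ρ ω)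
    (h : ∀ n : ℤ, n ≠ 0 → fourierCoeff (fun ω => (ρ ω : ℂ)) n = 0) :
    ∀ᵐ ω ∂dω, ρ ω = ∫ ω, ρ ω ∂dω := by
  set C := ∫ ω, ρ ω ∂dω with hC
  have hC0 : 0 ≤ C := integral_nonneg h0
  have hk : ∀ n, fourierCoeff (fun ω => (ρ ω : ℂ) + (-C : ℂ)) n = 0 := by
    intro n
    rw [fourierCoeff_fun_add (f := fun ω => (ρ ω : ℂ)) hρ.ofReal (integrable_const _),
      fourierCoeff_const]
    by_cases hn : n = 0
    · subst hn
      rw [fourierCoeff_eq]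
      simp [integral_complex_ofReal, hC]
    · rw [h n hn, if_neg hn, add_zero]
  have hki : Integrable (fun ω => (ρ ω : ℂ) + (-C : ℂ)) dω := hρ.ofReal.add (integrable_const _)
  have hden : dω.withDensity (fun ω => ENNReal.ofReal (ρ ω))
      = dω.withDensity (fun _ => ENNReal.ofReal C) := by
    have : IsFiniteMeasure (dω.withDensity fun ω => ENNReal.ofReal (ρ ω)) :=
      isFiniteMeasure_withDensity_ofReal hρ.2
    have : IsFiniteMeasure (dω.withDensity (fun _ => ENNReal.ofReal C)) :=
      isFiniteMeasure_withDensity_ofReal (integrable_const C).2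
    refine ext_of_forall_integral_eq_of_IsFiniteMeasure fun g => ?_
    rw [integral_withDensity_eq_integral_toReal_smul₀ hρ.aemeasurable.ennreal_ofReal
      (.of_forall fun _ => ENNReal.ofReal_lt_top),
      integral_withDensity_eq_integral_toReal_smul₀ aemeasurable_const
      (.of_forall fun _ => ENNReal.ofReal_lt_top)]
    have h1 := integral_continuousMap_mul_eq_zero hki hk
      ⟨fun ω => (g ω : ℂ), Complex.continuous_ofReal.comp g.continuous⟩
    have h2 : ∫ ω, g ω * (ρ ω + -C) ∂dω = 0 := by
      simp only [ContinuousMap.coe_mk] at h1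
      have h3 : (∫ ω, ((g ω * (ρ ω + -C) : ℝ) : ℂ) ∂dω) = 0 := by
        rw [← h1]; congr 1 with ω; push_cast; ring
      rw [integral_complex_ofReal] at h3
      exact_mod_cast h3
    have hgb : MemLp (fun ω => g ω) ∞ dω := memLp_of_continuous g.continuous ∞
    have i1 : Integrable (fun ω => g ω * ρ ω) dω := hρ.mul_of_top_right hgb
    have i2 : Integrable (fun ω => g ω * -C) dω := (integrable_const (-C)).mul_of_top_right hgb
    simp only [mul_add] at h2
    rw [integral_add i1 i2] at h2
    simp only [mul_neg, integral_neg] at h2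
    simp only [ENNReal.toReal_ofReal (h0 _), ENNReal.toReal_ofReal hC0, smul_eq_mul]
    simp only [mul_comm] at h2 ⊢
    linarith
  rw [withDensity_eq_iff_of_sigmaFinite hρ.aemeasurable.ennreal_ofReal aemeasurable_const] at hden
  filter_upwards [hden] with ω hω
  exact (ENNReal.ofReal_eq_ofReal_iff (h0 ω) hC0).1 hω

lemma IsSpectralFactor.of_ae_eq {N N' : Freq → ℝ} {L : Freq → ℂ} (h : IsSpectralFactor N L)
    (hN : N =ᵐ[dω] N') : IsSpectralFactor N' L := by
  obtain ⟨h1, h2, h3, h4, h5, h6⟩ := h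
  refine ⟨h1, h2, h3, h4, ?_, h6⟩
  filter_upwards [h5, hN] with ω a b
  rw [a, b]

/-- Szegő's projection: in `L²(N dω)` the function `1` is projected on the orthogonal complement
of the strictly causal functions. -/
lemma exists_prediction_error {N : Freq → ℝ} (hN : Measurable N) (h1 : ∀ ω, 1 ≤ N ω) {M : ℝ}
    (hM : ∀ ω, N ω ≤ M) :
    ∃ φ : Freq → ℂ, MemLp φ 2 dω ∧ Causal φ ∧ fourierCoeff φ 0 = 1 ∧
      Causal fun ω => conj (φ ω) * N ω := by
  obtain ⟨w, hw0, hwN, hwconj, hwb, hwib⟩ : ∃ w : Freq → ℂ, (∀ ω, w ω ≠ 0) ∧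
      (∀ ω, w ω * w ω = N ω) ∧ (∀ ω, conj (w ω) = w ω) ∧ MemLp w ∞ dω ∧
      MemLp (fun ω => (w ω)⁻¹) ∞ dω := by
    have hwm : Measurable fun ω => (√(N ω) : ℂ) := Complex.measurable_ofReal.comp hN.sqrt
    refine ⟨fun ω => (√(N ω) : ℂ), fun ω => ?_, fun ω => ?_, fun ω => Complex.conj_ofReal _,
      memLp_top_of_bound hwm.aestronglyMeasurable (√M) (.of_forall fun ω => ?_),
      memLp_top_of_bound hwm.inv.aestronglyMeasurable 1 (.of_forall fun ω => ?_)⟩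
    · exact Complex.ofReal_ne_zero.2 (Real.sqrt_pos.2 (by linarith [h1 ω])).ne'
    · rw [← Complex.ofReal_mul, Real.mul_self_sqrt (by linarith [h1 ω])]
    · rw [Complex.norm_real, Real.norm_of_nonneg (Real.sqrt_nonneg _)]
      exact Real.sqrt_le_sqrt (hM ω)
    · rw [norm_inv, Complex.norm_real, Real.norm_of_nonneg (Real.sqrt_nonneg _)]
      exact inv_le_one_of_one_le₀ (Real.one_le_sqrt.2 (h1 ω))
  have hpow : ∀ n : ℤ, MemLp (fun ω => ejω ω ^ n) 2 dω := fun n =>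
    memLp_of_continuous (continuous_ejω.zpow₀ n fun ω => Or.inl (ejω_ne_zero ω)) 2
  have hv : ∀ n : ℤ, MemLp (fun ω => (w ω)⁻¹ * ejω ω ^ n) 2 dω := fun n => (hpow n).mul hwib
  have hw2 : ∀ n : ℤ, MemLp (fun ω => w ω * ejω ω ^ n) 2 dω := fun n => (hpow n).mul hwb
  -- Multiplication by `w = √N` turns `L²(N dω)` into `L²(dω)`. The orthogonal complement of this
  -- span consists of the images of the strictly causal functions, and it is closed, so the
  -- projection onto it exists.
  set K : Submodule ℂ (Lp ℂ 2 dω) :=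
    Submodule.span ℂ (Set.range fun n : ℕ => (hv n).toLp) with hK
  have hmem : ∀ x : Lp ℂ 2 dω, x ∈ Kᗮ ↔
      ∀ n : ℕ, fourierCoeff (fun ω => (w ω)⁻¹ * x ω) n = 0 := by
    intro x
    have hin : ∀ n : ℕ, inner ℂ (hv n).toLp x = fourierCoeff (fun ω => (w ω)⁻¹ * x ω) n := by
      intro n
      rw [L2.inner_def, fourierCoeff_eq]
      refine integral_congr_ae ?_
      filter_upwards [(hv n).coeFn_toLp] with ω hω
      rw [hω, RCLike.inner_apply, map_mul, map_inv₀, hwconj, map_zpow₀, conj_ejω, inv_zpow']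
      ring
    rw [hK, Submodule.mem_orthogonal]
    constructor
    · intro h n
      rw [← hin]
      exact h _ (Submodule.subset_span ⟨n, rfl⟩)
    · intro h u hu
      induction hu using Submodule.span_induction with
      | mem u hu =>
        obtain ⟨n, rfl⟩ := hu
        exact (hin n).trans (h n)
      | zero => simp
      | add u v _ _ hu hv => rw [inner_add_left, hu, hv, add_zero]
      | smul a u _ hu => rw [inner_smul_left, hu, mul_zero]
  obtain ⟨m, hmK, heK⟩ : ∃ m ∈ Kᗮ, (hw2 0).toLp - m ∈ Kᗮᗮ :=
    ⟨Kᗮ.starProjection (hw2 0).toLp, Submodule.starProjection_apply_mem _ _,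
      Submodule.sub_starProjection_mem_orthogonal _⟩
  have hm2 : MemLp (fun ω => (w ω)⁻¹ * m ω) 2 dω := (Lp.memLp m).mul hwib
  have hm0 : ∀ n : ℤ, 0 ≤ n → fourierCoeff (fun ω => (w ω)⁻¹ * m ω) n = 0 := by
    intro n hn
    obtain ⟨k, rfl⟩ := Int.eq_ofNat_of_zero_le hn
    exact (hmem m).1 hmK k
  have hφ : ∀ n : ℤ, 0 ≤ n →
      fourierCoeff (fun ω => 1 + -1 * ((w ω)⁻¹ * m ω)) n = if n = 0 then 1 else 0 := by
    intro n hn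
    rw [fourierCoeff_fun_add (integrable_const _) ((hm2.integrable one_le_two).const_mul _),
      fourierCoeff.const_mul, hm0 n hn, fourierCoeff_const, mul_zero, add_zero]
  -- The strictly causal monomials, which the residual `w - m` must be orthogonal to; this
  -- orthogonality is the causality of `φ̄ N`.
  have hx : ∀ n : ℤ, 0 < n → (hw2 (-n)).toLp ∈ Kᗮ := by
    intro n hn
    rw [hmem]
    intro j
    have : (fun ω => (w ω)⁻¹ * ((hw2 (-n)).toLp _ : Lp ℂ 2 dω) ω) =ᵐ[dω] fourier (-n) := by
      filter_upwards [(hw2 (-n)).coeFn_toLp] with ω hω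
      rw [hω, fourier_eq_zpow, inv_mul_cancel_left₀ (hw0 ω)]
    rw [fourierCoeff_congr_ae this, fourierCoeff_fourier]
    exact Pi.single_eq_of_ne (by omega) _
  have hφ2 : MemLp (fun ω => 1 + -1 * ((w ω)⁻¹ * m ω)) 2 dω :=
    (memLp_const (1 : ℂ)).add (hm2.const_mul (-1))
  refine ⟨fun ω => 1 + -1 * ((w ω)⁻¹ * m ω), hφ2, fun n hn => ?_, ?_, fun n hn => ?_⟩
  · rw [hφ n hn.le, if_neg hn.ne']
  · rw [hφ 0 le_rfl, if_pos rfl]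
  · rw [← (Submodule.mem_orthogonal' _ _).1 heK _ (hx n hn), L2.inner_def, fourierCoeff_eq]
    refine integral_congr_ae ?_
    filter_upwards [(hw2 (-n)).coeFn_toLp, Lp.coeFn_sub (hw2 0).toLp m, (hw2 0).coeFn_toLp]
      with ω a b d
    rw [a, b, Pi.sub_apply, d, RCLike.inner_apply, ← hwN]
    simp only [map_sub, map_add, map_mul, hwconj, map_inv₀, map_neg, map_one, zpow_zero, mul_one]
    have := hw0 ω
    field_simp
    ring

/-- For the prediction error `φ` both `φ` and `u = φ̄ N` are causal, so `|φ|² N = φ u` is causal and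
real, hence a constant `C`, positive because `φ` has leading coefficient `1`. Then `L = u / √C` has
inverse `φ / √C`. -/
lemma exists_isSpectralFactor {N : Freq → ℝ} (hN : Measurable N) (h1 : ∀ ω, 1 ≤ N ω) {M : ℝ}
    (hM : ∀ ω, N ω ≤ M) : ∃ L, IsSpectralFactor N L := by
  obtain ⟨φ, hφ2, hφc, hφ0, huc⟩ := exists_prediction_error hN h1 hM
  set u : Freq → ℂ := fun ω => conj (φ ω) * N ω with hu
  have hN0 : ∀ ω, 0 < N ω := fun ω => by linarith [h1 ω]
  have hNb : MemLp (fun ω => (N ω : ℂ)) ∞ dω := by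
    refine memLp_top_of_bound (Complex.measurable_ofReal.comp hN).aestronglyMeasurable M
      (.of_forall fun ω => ?_)
    rw [Complex.norm_real, Real.norm_of_nonneg (hN0 ω).le]
    exact hM ω
  have hu2 : MemLp u 2 dω := hNb.mul hφ2.star
  set ρ : Freq → ℝ := fun ω => ‖φ ω‖ ^ 2 * N ω with hρ
  have hρu : ∀ ω, (ρ ω : ℂ) = φ ω * u ω := fun ω => by
    rw [hρ, hu, ← mul_assoc, Complex.mul_conj']
    push_cast
    rfl
  have hρc : Causal fun ω => (ρ ω : ℂ) := by
    simp only [hρu]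
    exact hφc.mul huc hφ2 hu2
  have hρi' : Integrable (fun ω => (ρ ω : ℂ)) dω := by
    simp only [hρu]
    exact hφ2.integrable_mul hu2
  have hρi : Integrable ρ dω := hρi'.re
  have hconst := ae_eq_of_fourierCoeff_nonneg hρi (fun ω => by
    have := (hN0 ω).le
    positivity) fun n hn => by
      rcases lt_or_gt_of_ne hn with hn | hn
      · have := fourierCoeff_conj (fun ω => (ρ ω : ℂ)) n
        simp only [Complex.conj_ofReal] at this
        rw [this, hρc _ (by omega), map_zero]
      · exact hρc n hn
  set C := ∫ ω, ρ ω ∂dω with hC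
  have hu0 : fourierCoeff u 0 = C := by
    have h := fourierCoeff_zero_mul hφc huc hφ2 hu2
    rw [hφ0, one_mul] at h
    rw [← h, fourierCoeff_eq]
    simp only [neg_zero, zpow_zero, one_mul, ← hρu]
    exact integral_complex_ofReal
  have hC0 : 0 < C := by
    refine lt_of_le_of_ne (integral_nonneg fun ω => ?_) fun h => ?_
    · have := (hN0 ω).le
      positivity
    · have h0 : φ =ᵐ[dω] fun _ => 0 := by
        filter_upwards [hconst] with ω hω
        rw [← h] at hω
        have := (mul_eq_zero.1 hω).resolve_right (hN0 ω).ne'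
        simpa using this
      rw [fourierCoeff_congr_ae h0, fourierCoeff_const] at hφ0
      simp at hφ0
  have hsC : (√C : ℂ) ≠ 0 := by exact_mod_cast (Real.sqrt_pos.2 hC0).ne'
  have hsC2 : (√C : ℂ) * √C = C := by exact_mod_cast Real.mul_self_sqrt hC0.le
  have hφne : ∀ᵐ ω ∂dω, φ ω ≠ 0 := by
    filter_upwards [hconst] with ω hω h
    simp only [hρ, h] at hω
    simp at hω
    exact hC0.ne hω
  have hinv : (fun ω => ((√C : ℂ)⁻¹ * u ω)⁻¹) =ᵐ[dω] fun ω => (√C : ℂ)⁻¹ * φ ω := by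
    filter_upwards [hconst, hφne] with ω hω h
    have h2 := hρu ω
    rw [hω, ← hsC2] at h2
    have h3 : u ω = √C * √C / φ ω := by
      rw [h2]; field_simp
    rw [h3]
    field_simp
  refine ⟨fun ω => (√C : ℂ)⁻¹ * u ω, hu2.const_mul _, huc.const_mul _,
    (hφ2.const_mul _).ae_eq hinv.symm, (hφc.const_mul _).congr hinv.symm, ?_, ?_⟩
  · filter_upwards [hconst] with ω hω
    have h4 : ‖u ω‖ = ‖φ ω‖ * N ω := by
      rw [hu, norm_mul, Complex.norm_conj, Complex.norm_real, Real.norm_of_nonneg (hN0 ω).le]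
    rw [norm_mul, norm_inv, Complex.norm_real, Real.norm_of_nonneg (Real.sqrt_nonneg _), mul_pow,
      inv_pow, Real.sq_sqrt hC0.le, h4, inv_mul_eq_iff_eq_mul₀ hC0.ne', ← hω, hρ]
    ring
  · rw [fourierCoeff.const_mul, hu0, ← hsC2, inv_mul_cancel_left₀ hsC]
    exact ⟨by simpa using Real.sqrt_pos.2 hC0, Complex.ofReal_im _⟩

/-! ### Comparison of spectral factors -/

lemma IsSpectralFactor.const_mul {N : Freq → ℝ} {L : Freq → ℂ} (h : IsSpectralFactor N L) {t : ℝ}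
    (ht : 0 < t) : IsSpectralFactor (fun ω => t * N ω) (fun ω => (√t : ℂ) * L ω) := by
  obtain ⟨h1, h2, h3, h4, h5, h6, h7⟩ := h
  have hs := Real.sqrt_pos.2 ht
  refine ⟨h1.const_mul _, h2.const_mul _, ?_, ?_, ?_, ?_⟩
  · simp only [mul_inv]
    exact h3.const_mul _
  · simp only [mul_inv]
    exact h4.const_mul _
  · filter_upwards [h5] with ω hω
    rw [norm_mul, mul_pow, hω, Complex.norm_real, Real.norm_of_nonneg hs.le, Real.sq_sqrt ht.le]
  · rw [fourierCoeff.const_mul, Complex.re_ofReal_mul, Complex.im_ofReal_mul, h7]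
    exact ⟨mul_pos hs h6, mul_zero _⟩

section

variable {c : ℝ} {N N₁ N₂ : Freq → ℝ} {L L₁ L₂ : Freq → ℂ}

lemma IsSpectralFactor.ae_ne_zero (h : IsSpectralFactor N L) (hN : ∀ᵐ ω ∂dω, 0 < N ω) :
    ∀ᵐ ω ∂dω, L ω ≠ 0 := by
  filter_upwards [h.2.2.2.2.1, hN] with ω h1 h2 h3
  rw [h3] at h1
  simp at h1
  exact h2.ne h1

lemma IsSpectralFactor.evalAt_ne_zero (hc : |c| < 1) (h : IsSpectralFactor N L)
    (hN : ∀ᵐ ω ∂dω, 0 < N ω) : evalAt c L ≠ 0 := by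
  have h1 := evalAt_mul hc h.2.1 h.2.2.2.1 h.1 h.2.2.1
  have h2 : (fun ω => L ω * (L ω)⁻¹) =ᵐ[dω] fun _ => 1 := by
    filter_upwards [h.ae_ne_zero hN] with ω hω
    exact mul_inv_cancel₀ hω
  rw [evalAt_congr h2, evalAt_const hc] at h1
  exact left_ne_zero_of_mul (h1 ▸ one_ne_zero)

/-- Causal invertibility of `L₂` makes the quotient causal, and the order of the spectra bounds it
by one: the setting of the maximum principle. -/
lemma IsSpectralFactor.quotient (h₁ : IsSpectralFactor N₁ L₁) (h₂ : IsSpectralFactor N₂ L₂)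
    (hN : ∀ᵐ ω ∂dω, 0 < N₁ ω) (hle : ∀ᵐ ω ∂dω, N₁ ω ≤ N₂ ω) :
    Causal (fun ω => L₁ ω * (L₂ ω)⁻¹) ∧ MemLp (fun ω => L₁ ω * (L₂ ω)⁻¹) 2 dω ∧
      (∀ᵐ ω ∂dω, ‖L₁ ω * (L₂ ω)⁻¹‖ ≤ 1) ∧
      (|c| < 1 → evalAt c L₁ = evalAt c (fun ω => L₁ ω * (L₂ ω)⁻¹) * evalAt c L₂) := by
  have hb : ∀ᵐ ω ∂dω, ‖L₁ ω * (L₂ ω)⁻¹‖ ≤ 1 := by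
    filter_upwards [h₁.2.2.2.2.1, h₂.2.2.2.2.1, hN, hle] with ω a b d e
    have h2 : 0 < ‖L₂ ω‖ ^ 2 := by linarith
    have h3 : 0 < ‖L₂ ω‖ := by
      by_contra h
      have : ‖L₂ ω‖ = 0 := le_antisymm (not_lt.1 h) (norm_nonneg _)
      simp [this] at h2
    rw [norm_mul, norm_inv, ← div_eq_mul_inv, div_le_one h3]
    exact (sq_le_sq₀ (norm_nonneg _) (norm_nonneg _)).1 (by linarith)
  have hc1 := h₁.2.1.mul h₂.2.2.2.1 h₁.1 h₂.2.2.1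
  have hm : MemLp (fun ω => L₁ ω * (L₂ ω)⁻¹) 2 dω :=
    MemLp.of_bound (h₁.1.1.mul h₂.2.2.1.1) 1 hb
  refine ⟨hc1, hm, hb, fun hc => ?_⟩
  rw [← evalAt_mul hc hc1 h₂.2.1 hm h₂.1]
  refine evalAt_congr ?_
  filter_upwards [h₂.ae_ne_zero (by filter_upwards [hN, hle] with ω a b; linarith)] with ω hω
  rw [inv_mul_cancel_right₀ hω]

lemma IsSpectralFactor.norm_evalAt_le (hc : |c| < 1) (h₁ : IsSpectralFactor N₁ L₁)
    (h₂ : IsSpectralFactor N₂ L₂) (hN : ∀ᵐ ω ∂dω, 0 < N₁ ω) (hle : ∀ᵐ ω ∂dω, N₁ ω ≤ N₂ ω) :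
    ‖evalAt c L₁‖ ≤ ‖evalAt c L₂‖ := by
  obtain ⟨h1, h2, h3, h4⟩ := h₁.quotient (c := c) h₂ hN hle
  rw [h4 hc, norm_mul]
  exact mul_le_of_le_one_left (norm_nonneg _) (norm_evalAt_le_one hc h1 h2 h3)

/-- Equality at one interior point forces the quotient `L₁ / L₂` to be unimodular. Uniqueness of the
fixed point rests on this. -/
lemma IsSpectralFactor.ae_eq_of_norm_evalAt_le (hc : |c| < 1) (h₁ : IsSpectralFactor N₁ L₁)
    (h₂ : IsSpectralFactor N₂ L₂) (hN : ∀ᵐ ω ∂dω, 0 < N₁ ω) (hle : ∀ᵐ ω ∂dω, N₁ ω ≤ N₂ ω)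
    (h : ‖evalAt c L₂‖ ≤ ‖evalAt c L₁‖) : N₁ =ᵐ[dω] N₂ := by
  obtain ⟨h1, h2, h3, h4⟩ := h₁.quotient (c := c) h₂ hN hle
  have hN2 : ∀ᵐ ω ∂dω, 0 < N₂ ω := by filter_upwards [hN, hle] with ω a b; linarith
  have hpos := norm_pos_iff.2 (h₂.evalAt_ne_zero hc hN2)
  rw [h4 hc, norm_mul] at h
  have h5 := norm_ae_eq_one_of_one_le_norm_evalAt hc h1 h2 h3 (by
    by_contra hlt
    nlinarith [not_le.1 hlt])
  filter_upwards [h5, h₁.2.2.2.2.1, h₂.2.2.2.2.1, h₂.ae_ne_zero hN2] with ω a b d e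
  rw [norm_mul, norm_inv, mul_inv_eq_one₀ (norm_ne_zero_iff.2 e)] at a
  rw [← b, ← d, a]

end

open Matrix

/-! ### Rank-one perturbations of the identity -/

section

variable {m : ℕ} {R : Type*} [CommRing R] (u v : Fin m → R)

lemma one_add_smul_vecMulVec_mul (x y : R) :
    (1 + x • vecMulVec u v) * (1 + y • vecMulVec u v)
      = 1 + (x + y + x * y * (v ⬝ᵥ u)) • vecMulVec u v := by
  rw [add_mul, mul_add, mul_add, smul_mul_smul_comm, vecMulVec_mul_vecMulVec, vecMulVec_smul]
  simp only [one_mul, mul_one, smul_smul, add_smul]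
  abel

lemma one_add_smul_vecMulVec_mulVec (x : R) (w : Fin m → R) :
    (1 + x • vecMulVec u v) *ᵥ w = w + (x * (v ⬝ᵥ w)) • u := by
  rw [add_mulVec, one_mulVec, smul_mulVec, vecMulVec_mulVec]
  ext i
  simp
  ring

end

lemma inv_one_add_smul_vecMulVec {m : ℕ} {𝕜 : Type*} [Field 𝕜] (u v : Fin m → 𝕜) {x : 𝕜}
    (hx : 1 + x * (v ⬝ᵥ u) ≠ 0) :
    (1 + x • vecMulVec u v)⁻¹ = 1 + (-x / (1 + x * (v ⬝ᵥ u))) • vecMulVec u v := by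
  refine Matrix.inv_eq_right_inv ?_
  rw [one_add_smul_vecMulVec_mul]
  have : x + -x / (1 + x * (v ⬝ᵥ u)) + x * (-x / (1 + x * (v ⬝ᵥ u))) * (v ⬝ᵥ u) = 0 := by
    field_simp
    ring
  rw [this, zero_smul, add_zero]

namespace Plant

variable {m : ℕ} (p : Plant m)

/-! ### The Riccati equation -/

/-- `‖Bᵤ‖²`. -/
def beta : ℝ := p.Bu ⬝ᵥ p.Bu

/-- The square root of `1 + P ‖Bᵤ‖²`. -/
def gain : ℝ := √(1 + p.P * p.beta)

lemma beta_nonneg : 0 ≤ p.beta := by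
  unfold beta dotProduct
  exact Finset.sum_nonneg fun i _ => mul_self_nonneg _

lemma lqrWeight_inv_mulVec {P : ℝ} (hP : 0 < P) :
    (p.lqrWeight P)⁻¹ *ᵥ p.Bu = (1 + P * p.beta)⁻¹ • p.Bu := by
  have hb := mul_nonneg hP.le p.beta_nonneg
  have h : 1 + P * (p.Bu ⬝ᵥ p.Bu) ≠ 0 := by
    change 1 + P * p.beta ≠ 0
    linarith
  rw [lqrWeight, inv_one_add_smul_vecMulVec _ _ h, one_add_smul_vecMulVec_mulVec]
  change _ + (-P / (1 + P * p.beta) * p.beta) • _ = _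
  have h' : 1 + P * p.beta ≠ 0 := h
  ext i
  simp only [Pi.add_apply, Pi.smul_apply, smul_eq_mul]
  field_simp
  ring

lemma sub_dotProduct_lqrGain {P : ℝ} (hP : 0 < P) :
    p.a - p.Bu ⬝ᵥ p.lqrGain P = p.a / (1 + P * p.beta) := by
  have hb := mul_nonneg hP.le p.beta_nonneg
  have h : 1 + P * p.beta ≠ 0 := by linarith
  rw [lqrGain, lqrWeight_inv_mulVec p hP, dotProduct_smul, dotProduct_smul]
  change p.a - (P * p.a) • (1 + P * p.beta)⁻¹ • p.beta = _
  simp only [smul_eq_mul]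
  field_simp
  ring

lemma isRiccati_iff {P : ℝ} (hP : 0 < P) : p.IsRiccati P ↔
    P = 1 + p.a ^ 2 * P / (1 + P * p.beta) ∧ |p.a / (1 + P * p.beta)| < 1 := by
  have hb := mul_nonneg hP.le p.beta_nonneg
  have h : 1 + P * p.beta ≠ 0 := by linarith
  rw [IsRiccati, sub_dotProduct_lqrGain p hP, lqrWeight_inv_mulVec p hP, dotProduct_smul]
  change (0 < P ∧ P = 1 + p.a * P * p.a - p.a * P * ((1 + P * p.beta)⁻¹ • p.beta) * P * p.a ∧ _) ↔ _
  have : 1 + p.a * P * p.a - p.a * P * ((1 + P * p.beta)⁻¹ • p.beta) * P * p.a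
      = 1 + p.a ^ 2 * P / (1 + P * p.beta) := by
    simp only [smul_eq_mul]
    field_simp
    ring
  rw [this]
  simp [hP]

variable {p}

lemma exists_isRiccati (hu : p.StabilizableU) : ∃ P, p.IsRiccati P := by
  rcases p.beta_nonneg.eq_or_lt with hb | hb
  · have hB : p.Bu = 0 := dotProduct_self_eq_zero.1 hb.symm
    obtain ⟨k, hk⟩ := hu
    rw [hB, zero_dotProduct, sub_zero] at hk
    have h2 : 0 < 1 - p.a ^ 2 := by linarith [(sq_lt_one_iff_abs_lt_one p.a).2 hk]
    refine ⟨1 / (1 - p.a ^ 2), (isRiccati_iff p (by positivity)).2 ?_⟩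
    rw [← hb]
    simp only [mul_zero, add_zero, div_one]
    refine ⟨?_, hk⟩
    field_simp
    ring
  -- For `β = ‖Bᵤ‖² > 0` the Riccati equation is the quadratic `β P² + e P - 1 = 0`, whose roots
  -- have opposite signs; take the positive one.
  · set e := 1 - p.beta - p.a ^ 2 with he
    set s := √(e ^ 2 + 4 * p.beta) with hs
    have hs2 : s ^ 2 = e ^ 2 + 4 * p.beta := Real.sq_sqrt (by positivity)
    have hse : |e| < s := by
      rw [← Real.sqrt_sq_eq_abs]
      exact Real.sqrt_lt_sqrt (sq_nonneg _) (by linarith)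
    set P := (s - e) / (2 * p.beta) with hPd
    have hP : 0 < P := div_pos (by linarith [le_abs_self e]) (by linarith)
    have hq : p.beta * P ^ 2 + e * P - 1 = 0 := by
      rw [hPd]
      field_simp
      nlinarith
    have hd : 0 < 1 + P * p.beta := by positivity
    have hR : P * (1 + P * p.beta) = 1 + P * p.beta + p.a ^ 2 * P := by
      rw [he] at hq
      linarith
    refine ⟨P, (isRiccati_iff p hP).2 ⟨?_, ?_⟩⟩
    · field_simp
      linarith
    · rw [← sq_lt_one_iff_abs_lt_one, div_pow, div_lt_one (by positivity)]
      -- The Riccati equation reads `P (1 + P β - a²) = 1 + P β`, and the right side is positive.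
      have h1 : p.a ^ 2 < 1 + P * p.beta := by
        by_contra hcon
        nlinarith
      nlinarith [mul_pos hP hb]

lemma isRiccati_P (hu : p.StabilizableU) : p.IsRiccati p.P :=
  Classical.epsilon_spec (exists_isRiccati hu)

lemma P_pos (hu : p.StabilizableU) : 0 < p.P := (isRiccati_P hu).1

lemma one_add_P_mul_beta_pos (hu : p.StabilizableU) : 0 < 1 + p.P * p.beta := by
  have := P_pos hu
  have := p.beta_nonneg
  positivity

lemma gain_pos (hu : p.StabilizableU) : 0 < p.gain := Real.sqrt_pos.2 (one_add_P_mul_beta_pos hu)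

lemma gain_sq (hu : p.StabilizableU) : p.gain ^ 2 = 1 + p.P * p.beta :=
  Real.sq_sqrt (one_add_P_mul_beta_pos hu).le

lemma abs_Abar_lt_one (hu : p.StabilizableU) : |p.Abar| < 1 := (isRiccati_P hu).2.2

lemma Abar_eq (hu : p.StabilizableU) : p.Abar = p.a / (1 + p.P * p.beta) :=
  sub_dotProduct_lqrGain p (P_pos hu)

lemma gain_sq_mul_Abar (hu : p.StabilizableU) : p.gain ^ 2 * p.Abar = p.a := by
  rw [gain_sq hu, Abar_eq hu, mul_div_cancel₀ _ (one_add_P_mul_beta_pos hu).ne']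

lemma P_mul_one_sub (hu : p.StabilizableU) : p.P * (1 - p.a * p.Abar) = 1 := by
  have h := ((isRiccati_iff p (P_pos hu)).1 (isRiccati_P hu)).1
  rw [Abar_eq hu]
  rw [sq, mul_assoc, mul_div_assoc, mul_comm p.a p.P, mul_div_assoc] at h
  linear_combination h

lemma Cbar_eq (hu : p.StabilizableU) : p.Cbar = -(p.gain⁻¹ • p.Bu) := by
  have hr := gain_pos hu
  have hr2 := gain_sq hu
  have hP := P_pos hu
  -- The positive solution of `2 k + k² β = P`, so that `1 + k Bᵤ Bᵤᵀ` squares to `1 + P Bᵤ Bᵤᵀ`.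
  set k := p.P / (p.gain + 1) with hk
  have hkP : k * (p.gain + 1) = p.P := div_mul_cancel₀ _ (by linarith)
  have hk0 : 0 < k := by positivity
  have hkb : k * p.beta = p.gain - 1 := by
    have h1 : (p.gain + 1) * (k * p.beta) = (p.gain + 1) * (p.gain - 1) := by
      linear_combination p.beta * hkP - hr2
    exact mul_left_cancel₀ (by linarith) h1
  have hdot : 1 + k * (p.Bu ⬝ᵥ p.Bu) = p.gain := by
    change 1 + k * p.beta = _
    linarith
  have hsq : CFC.sqrt (p.lqrWeight p.P) = 1 + k • vecMulVec p.Bu p.Bu := by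
    refine CFC.sqrt_unique ?_ ?_
    · rw [one_add_smul_vecMulVec_mul, lqrWeight]
      congr 2
      change k + k + k * k * p.beta = _
      linear_combination hkP + k * hkb
    · rw [Matrix.nonneg_iff_posSemidef]
      exact Matrix.PosSemidef.one.add ((posSemidef_vecMulVec_self_star p.Bu).smul hk0.le)
  rw [Cbar, hsq, inv_one_add_smul_vecMulVec _ _ (by rw [hdot]; exact hr.ne'), hdot,
    transpose_add, transpose_one, transpose_smul, transpose_vecMulVec,
    one_add_smul_vecMulVec_mulVec]
  congr 1
  change _ + (_ * p.beta) • _ = _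
  ext i
  simp only [Pi.add_apply, Pi.smul_apply, smul_eq_mul]
  have : -k / p.gain * p.beta = p.gain⁻¹ - 1 := by
    field_simp
    linarith
  rw [this]
  ring

/-- `r² |z - Ā|² = |z - a|² + ‖Bᵤ‖²`. -/
lemma spectral_identity (hu : p.StabilizableU) (ω : Freq) :
    (p.gain : ℂ) ^ 2 * ((ejω ω - p.Abar) * ((ejω ω)⁻¹ - p.Abar))
      = (ejω ω - p.a) * ((ejω ω)⁻¹ - p.a) + p.beta := by
  have h1 : (p.gain : ℂ) ^ 2 * p.Abar = p.a := by exact_mod_cast gain_sq_mul_Abar hu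
  have h2 : (p.gain : ℂ) ^ 2 = 1 + p.P * p.beta := by exact_mod_cast gain_sq hu
  have h3 : (p.P : ℂ) * (1 - p.a * p.Abar) = 1 := by exact_mod_cast P_mul_one_sub hu
  have h4 := mul_inv_cancel₀ (ejω_ne_zero ω)
  set z := ejω ω
  set y := z⁻¹
  have h5 : (p.a : ℂ) * p.Abar + p.beta * p.P = p.a ^ 2 + p.beta := by
    linear_combination p.beta * h3 + p.a * h1 - p.a * p.Abar * h2
  linear_combination ((p.gain : ℂ) ^ 2 - 1) * h4 - (z + y - p.Abar) * h1 + h2 + h5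

/-! ### The non-causal controller -/

/-- The rank-one inversion formula. It also holds at `z = a`, where the inverse is zero by
convention and both sides vanish. -/
lemma Knc_eq (p : Plant m) (ω : Freq) (i : Fin m) :
    p.Knc ω i = -(p.bw * ‖(ejω ω - p.a)⁻¹‖ ^ 2 / (1 + p.beta * ‖(ejω ω - p.a)⁻¹‖ ^ 2) * p.Bu i : ℝ)
    := by
  set g := (ejω ω - p.a)⁻¹ with hg
  have hF : p.F ω = fun i => g * p.Bu i := rfl
  have hdot : p.F ω ⬝ᵥ star (p.F ω) = ((p.beta * ‖g‖ ^ 2 : ℝ) : ℂ) := by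
    rw [hF, beta]
    simp only [dotProduct]
    push_cast
    rw [Finset.sum_mul]
    refine Finset.sum_congr rfl fun i _ => ?_
    rw [← Complex.mul_conj']
    simp only [Pi.star_apply, star_mul', RCLike.star_def, Complex.conj_ofReal]
    ring
  have hne' : 1 + p.beta * ‖g‖ ^ 2 ≠ 0 := by
    have := p.beta_nonneg
    positivity
  have hne : (1 : ℂ) + 1 * (p.F ω ⬝ᵥ star (p.F ω)) ≠ 0 := by
    rw [hdot, one_mul]
    exact_mod_cast hne'
  have hone : 1 + vecMulVec (star (p.F ω)) (p.F ω)
      = 1 + (1 : ℂ) • vecMulVec (star (p.F ω)) (p.F ω) := by rw [one_smul]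
  rw [Knc, hone, inv_one_add_smul_vecMulVec _ _ hne, one_add_smul_vecMulVec_mulVec, dotProduct_smul,
    hdot, hF, G, ← hg]
  simp only [Pi.neg_apply, Pi.add_apply, Pi.smul_apply, Pi.star_apply, star_mul', RCLike.star_def,
    Complex.conj_ofReal, smul_eq_mul]
  have h2 : (1 : ℂ) + p.beta * ‖g‖ ^ 2 ≠ 0 := by exact_mod_cast hne'
  have ht := Complex.mul_conj' g
  push_cast
  generalize (‖g‖ : ℂ) ^ 2 = t at h2 ht ⊢
  rw [one_mul]
  field_simp
  linear_combination -(p.bw * p.Bu i : ℂ) * ht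

lemma norm_closedLoop_sq (p : Plant m) (K : Freq → Fin m → ℂ) (ω : Freq) :
    ‖p.closedLoop K ω‖ ^ 2 = ‖p.F ω ⬝ᵥ K ω + p.G ω‖ ^ 2 + ∑ i, ‖K ω i‖ ^ 2 := by
  rw [EuclideanSpace.norm_sq_eq, Fintype.sum_sum_type]
  simp [closedLoop]

lemma dotProduct_F (p : Plant m) (v : Fin m → ℂ) (ω : Freq) :
    p.F ω ⬝ᵥ v = (ejω ω - p.a)⁻¹ * ((fun i => (p.Bu i : ℂ)) ⬝ᵥ v) := by
  simp only [dotProduct, F, Finset.mul_sum, mul_assoc]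

lemma sum_Bu_sq (p : Plant m) : (fun i => (p.Bu i : ℂ)) ⬝ᵥ (fun i => (p.Bu i : ℂ)) = p.beta := by
  simp [dotProduct, beta]

lemma F_dotProduct_Knc_add_G (p : Plant m) (ω : Freq) :
    p.F ω ⬝ᵥ p.Knc ω + p.G ω
      = (ejω ω - p.a)⁻¹ * (p.bw / (1 + p.beta * ‖(ejω ω - p.a)⁻¹‖ ^ 2) : ℝ) := by
  have h : p.Knc ω = (-(p.bw * ‖(ejω ω - p.a)⁻¹‖ ^ 2 / (1 + p.beta * ‖(ejω ω - p.a)⁻¹‖ ^ 2) : ℝ) : ℂ)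
      • fun i => (p.Bu i : ℂ) := by
    ext i
    rw [Knc_eq]
    simp
  have hne' : 1 + p.beta * ‖(ejω ω - p.a)⁻¹‖ ^ 2 ≠ 0 := by
    have := p.beta_nonneg
    positivity
  rw [h, dotProduct_smul, dotProduct_F, sum_Bu_sq, G, smul_eq_mul, mul_left_comm, ← mul_add]
  congr 1
  norm_cast
  generalize ‖(ejω ω - p.a)⁻¹‖ ^ 2 = t at hne' ⊢
  rw [mul_div_right_comm]
  linear_combination -(div_mul_cancel₀ p.bw hne')

lemma Tnc_eq (p : Plant m) (ω : Freq) :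
    p.Tnc ω = p.bw ^ 2 * ‖(ejω ω - p.a)⁻¹‖ ^ 2 / (1 + p.beta * ‖(ejω ω - p.a)⁻¹‖ ^ 2) := by
  have hne' : 1 + p.beta * ‖(ejω ω - p.a)⁻¹‖ ^ 2 ≠ 0 := by
    have := p.beta_nonneg
    positivity
  rw [Tnc, norm_closedLoop_sq, F_dotProduct_Knc_add_G, norm_mul, Complex.norm_real, mul_pow,
    Real.norm_eq_abs, sq_abs]
  simp only [Knc_eq, norm_neg, Complex.norm_real, Real.norm_eq_abs, sq_abs, mul_pow,
    ← Finset.mul_sum]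
  have : ∑ i, p.Bu i ^ 2 = p.beta := by simp [beta, dotProduct, sq]
  rw [this]
  field_simp

/-- Completion of squares: the closed-loop power in terms of a square root of `I + F* F`. -/
lemma norm_closedLoop_sq_eq (p : Plant m) (K : Freq → Fin m → ℂ) (ω : Freq)
    {D : Matrix (Fin m) (Fin m) ℂ}
    (hD : Dᴴ * D = 1 + vecMulVec (star (p.F ω)) (p.F ω)) :
    ‖p.closedLoop K ω‖ ^ 2 = ∑ i, ‖(D *ᵥ (p.Knc ω - K ω)) i‖ ^ 2 + p.Tnc ω := by
  obtain ⟨v, hv⟩ : ∃ v, v = p.Knc ω - K ω := ⟨_, rfl⟩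
  rw [← hv]
  have hK : K ω = p.Knc ω - v := by rw [hv, sub_sub_cancel]
  obtain ⟨e, he⟩ : ∃ e, e = p.F ω ⬝ᵥ p.Knc ω + p.G ω := ⟨_, rfl⟩
  -- The normal equations of the pointwise least-squares problem solved by `K_∘`; they cancel both
  -- cross terms of the square.
  have hnormal : ∀ i, conj (p.F ω i) * e + p.Knc ω i = 0 := by
    intro i
    have hne : (1 : ℂ) + p.beta * ‖(ejω ω - p.a)⁻¹‖ ^ 2 ≠ 0 := by
      have : 1 + p.beta * ‖(ejω ω - p.a)⁻¹‖ ^ 2 ≠ 0 := by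
        have := p.beta_nonneg
        positivity
      exact_mod_cast this
    rw [he, F_dotProduct_Knc_add_G, Knc_eq, F, map_mul, Complex.conj_ofReal]
    push_cast
    rw [← Complex.mul_conj'] at hne ⊢
    field_simp
    ring
  have hsum : ∀ w : Fin m → ℂ, ((∑ i, ‖w i‖ ^ 2 : ℝ) : ℂ) = star w ⬝ᵥ w := by
    intro w
    simp [dotProduct, ← Complex.conj_mul']
  have hDv : ((∑ i, ‖(D *ᵥ v) i‖ ^ 2 : ℝ) : ℂ)
      = star v ⬝ᵥ v + conj (p.F ω ⬝ᵥ v) * (p.F ω ⬝ᵥ v) := by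
    rw [hsum, star_mulVec, ← dotProduct_mulVec, mulVec_mulVec, hD, add_mulVec, one_mulVec,
      vecMulVec_mulVec, dotProduct_add]
    congr 1
    simp only [dotProduct, map_sum, map_mul, Pi.smul_apply, MulOpposite.smul_eq_mul_unop,
      MulOpposite.unop_op, Pi.star_apply, RCLike.star_def]
    rw [Finset.sum_mul]
    refine Finset.sum_congr rfl fun i _ => ?_
    ring
  have hcross : conj (p.F ω ⬝ᵥ v) * e + star v ⬝ᵥ p.Knc ω = 0 := by
    simp only [dotProduct, map_sum, map_mul, Finset.sum_mul, ← Finset.sum_add_distrib]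
    refine Finset.sum_eq_zero fun i _ => ?_
    simp only [Pi.star_apply, RCLike.star_def]
    linear_combination conj (v i) * hnormal i
  have hcross' : conj e * (p.F ω ⬝ᵥ v) + star (p.Knc ω) ⬝ᵥ v = 0 := by
    have h := congrArg (starRingEnd ℂ) hcross
    rw [map_add, map_mul, Complex.conj_conj, map_zero] at h
    rw [← h, mul_comm]
    congr 1
    simp [dotProduct, mul_comm]
  rw [Tnc, norm_closedLoop_sq, norm_closedLoop_sq]
  apply Complex.ofReal_injective
  rw [Complex.ofReal_add, Complex.ofReal_add, Complex.ofReal_add, hDv, hsum, hsum, hK,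
    dotProduct_sub]
  push_cast
  rw [← he, show p.F ω ⬝ᵥ p.Knc ω - p.F ω ⬝ᵥ v + p.G ω = e - p.F ω ⬝ᵥ v by rw [he]; ring,
    ← Complex.conj_mul', ← Complex.conj_mul', map_sub, star_sub, sub_dotProduct, dotProduct_sub, dotProduct_sub]
  linear_combination -hcross - hcross'

end Plant

open scoped ComplexConjugate InnerProductSpace ComplexOrder

/-! ### The algebra `H_∞` -/

section

variable {f g : Freq → ℂ}

lemma HInf.memLp (hf : HInf f) (q : ℝ≥0∞) : MemLp f q dω := hf.1.mono_exponent le_top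

lemma HInf.congr (hf : HInf f) (h : f =ᵐ[dω] g) : HInf g := ⟨hf.1.ae_eq h, hf.2.congr h⟩

lemma hInf_const (k : ℂ) : HInf fun _ => k := ⟨memLp_const k, causal_const k⟩

lemma hInf_kernel {c : ℝ} (hc : |c| < 1) : HInf fun ω => (ejω ω - c)⁻¹ :=
  ⟨memLp_of_continuous (continuous_causal_kernel hc) ∞, causal_kernel hc⟩

lemma HInf.integrable (hf : HInf f) : Integrable f dω := hf.1.integrable le_top

lemma HInf.add (hf : HInf f) (hg : HInf g) : HInf fun ω => f ω + g ω :=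
  ⟨hf.1.add hg.1, hf.2.add hg.2 hf.integrable hg.integrable⟩

lemma HInf.const_mul (hf : HInf f) (k : ℂ) : HInf fun ω => k * f ω :=
  ⟨hf.1.const_mul k, hf.2.const_mul k⟩

lemma HInf.neg (hf : HInf f) : HInf fun ω => -f ω := by
  simpa using hf.const_mul (-1)

lemma HInf.sub (hf : HInf f) (hg : HInf g) : HInf fun ω => f ω - g ω := by
  simpa [sub_eq_add_neg] using hf.add hg.neg

lemma HInf.mul (hf : HInf f) (hg : HInf g) : HInf fun ω => f ω * g ω :=
  ⟨hg.1.mul hf.1, hf.2.mul hg.2 (hf.memLp 2) (hg.memLp 2)⟩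

lemma HInf.sum {ι : Type*} (s : Finset ι) {f : ι → Freq → ℂ} (hf : ∀ i ∈ s, HInf (f i)) :
    HInf fun ω => ∑ i ∈ s, f i ω :=
  ⟨memLp_finsetSum s fun i hi => (hf i hi).1,
    Causal.sum s (fun i hi => (hf i hi).2) fun i hi => (hf i hi).integrable⟩

end

lemma conjTranspose_mul_inv_eq {m : ℕ} {A B : Matrix (Fin m) (Fin m) ℂ} (h : Aᴴ * A = Bᴴ * B)
    (hA : IsUnit A.det) (hB : IsUnit B.det) : (A * B⁻¹)ᴴ = B * A⁻¹ := by
  have hB' : IsUnit (Bᴴ).det := by rw [det_conjTranspose]; exact hB.star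
  have h1 : Aᴴ = Bᴴ * (B * A⁻¹) := by
    rw [← Matrix.mul_assoc, ← h, Matrix.mul_assoc, mul_nonsing_inv _ hA, Matrix.mul_one]
  rw [conjTranspose_mul, conjTranspose_nonsing_inv, h1, ← Matrix.mul_assoc,
    nonsing_inv_mul _ hB', Matrix.one_mul]

namespace Plant

variable {m : ℕ} {p : Plant m}

lemma isUnit_det_of_conjTranspose_mul {ω : Freq} {D : Matrix (Fin m) (Fin m) ℂ}
    (hD : Dᴴ * D = 1 + vecMulVec (star (p.F ω)) (p.F ω)) : IsUnit D.det := by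
  rw [isUnit_iff_ne_zero]
  intro h0
  obtain ⟨v, hv, hDv⟩ := Matrix.exists_mulVec_eq_zero_iff.2 h0
  have h1 : (1 + vecMulVec (star (p.F ω)) (p.F ω)) *ᵥ v = 0 := by
    rw [← hD, ← mulVec_mulVec, hDv, mulVec_zero]
  have h2 : star v ⬝ᵥ v + star (p.F ω ⬝ᵥ v) * (p.F ω ⬝ᵥ v) = 0 := by
    have h3 : star v ⬝ᵥ ((1 + vecMulVec (star (p.F ω)) (p.F ω)) *ᵥ v) = 0 := by
      rw [h1, dotProduct_zero]
    rw [add_mulVec, one_mulVec, vecMulVec_mulVec, dotProduct_add] at h3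
    rw [← h3]
    congr 1
    simp only [dotProduct, star_sum, star_mul', Pi.smul_apply, MulOpposite.smul_eq_mul_unop,
      MulOpposite.unop_op, Pi.star_apply]
    rw [Finset.sum_mul]
    refine Finset.sum_congr rfl fun i _ => ?_
    ring
  have h4 : 0 ≤ star v ⬝ᵥ v := dotProduct_star_self_nonneg v
  have h5 : 0 ≤ star (p.F ω ⬝ᵥ v) * (p.F ω ⬝ᵥ v) := star_mul_self_nonneg _
  have h6 : star v ⬝ᵥ v = 0 := le_antisymm (by rw [← h2]; exact le_add_of_nonneg_right h5) h4
  exact hv (dotProduct_star_self_eq_zero.1 h6)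

/-! ### The normalized coprime factorization -/

/-- `Bᵤ` as a complex vector. -/
def BuC (p : Plant m) : Fin m → ℂ := fun i => p.Bu i

/-- `P / (1 + √(1 + P ‖Bᵤ‖²))`. -/
def factorGain (p : Plant m) : ℝ := p.P / (p.gain + 1)

/-- The coefficient of `Bᵤ Bᵤᵀ` in the plant factor. -/
def factorCoeff (p : Plant m) (ω : Freq) : ℂ :=
  p.factorGain * (1 + (p.a + p.gain * p.Abar) * (ejω ω - p.a)⁻¹)

/-- The coefficient of `Bᵤ Bᵤᵀ` in the inverse of the plant factor. -/
def factorInvCoeff (p : Plant m) (ω : Freq) : ℂ :=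
  -(p.factorGain / p.gain) * (1 + (p.Abar + p.gain * p.Abar) * (ejω ω - p.Abar)⁻¹)

/-- The plant factor `Δ = (I + Bᵤᵀ P Bᵤ)^{1/2} (I + K_lqr (z - a)⁻¹ Bᵤ)`. -/
def factor (p : Plant m) (ω : Freq) : Matrix (Fin m) (Fin m) ℂ :=
  1 + p.factorCoeff ω • vecMulVec p.BuC p.BuC

lemma BuC_dotProduct (p : Plant m) : p.BuC ⬝ᵥ p.BuC = p.beta := sum_Bu_sq p

lemma factorGain_mul (hu : p.StabilizableU) : p.factorGain * (p.gain + 1) = p.P :=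
  div_mul_cancel₀ _ (by linarith [gain_pos hu])

lemma factorGain_mul_beta (hu : p.StabilizableU) : p.factorGain * p.beta = p.gain - 1 := by
  have h1 : (p.gain + 1) * (p.factorGain * p.beta) = (p.gain + 1) * (p.gain - 1) := by
    linear_combination p.beta * factorGain_mul hu - gain_sq hu
  exact mul_left_cancel₀ (by linarith [gain_pos hu]) h1

lemma gain_ne_zero (hu : p.StabilizableU) : (p.gain : ℂ) ≠ 0 := by
  exact_mod_cast (gain_pos hu).ne'

lemma factorCoeff_mul {ω : Freq} (hω : ejω ω ≠ p.a) :
    p.factorCoeff ω * (ejω ω - p.a) = p.factorGain * (ejω ω + p.gain * p.Abar) := by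
  have := sub_ne_zero.2 hω
  rw [factorCoeff]
  field_simp
  ring

lemma factorInvCoeff_mul (hu : p.StabilizableU) (ω : Freq) :
    p.gain * (p.factorInvCoeff ω * (ejω ω - p.Abar))
      = -p.factorGain * (ejω ω + p.gain * p.Abar) := by
  have := ejω_sub_ne_zero (abs_Abar_lt_one hu) ω
  have := gain_ne_zero hu
  rw [factorInvCoeff]
  field_simp
  ring

/-- On the line spanned by `Bᵤ` the plant factor acts as this scalar: the plant pole `a` is
exchanged for the stable closed-loop pole `Ā`. -/
lemma one_add_factorCoeff (hu : p.StabilizableU) {ω : Freq} (hω : ejω ω ≠ p.a) :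
    1 + p.factorCoeff ω * p.beta = p.gain * (ejω ω - p.Abar) * (ejω ω - p.a)⁻¹ := by
  have h0 := sub_ne_zero.2 hω
  have h1 : (p.factorGain : ℂ) * p.beta = p.gain - 1 := by exact_mod_cast factorGain_mul_beta hu
  have h2 : (p.gain : ℂ) ^ 2 * p.Abar = p.a := by exact_mod_cast gain_sq_mul_Abar hu
  rw [eq_mul_inv_iff_mul_eq₀ h0]
  linear_combination p.beta * factorCoeff_mul hω + (ejω ω + p.gain * p.Abar) * h1 + h2

lemma one_add_factorInvCoeff (hu : p.StabilizableU) (ω : Freq) :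
    1 + p.factorInvCoeff ω * p.beta = (ejω ω - p.a) * (p.gain * (ejω ω - p.Abar))⁻¹ := by
  have h0 := ejω_sub_ne_zero (abs_Abar_lt_one hu) ω
  have h1 : (p.factorGain : ℂ) * p.beta = p.gain - 1 := by exact_mod_cast factorGain_mul_beta hu
  have h2 : (p.gain : ℂ) ^ 2 * p.Abar = p.a := by exact_mod_cast gain_sq_mul_Abar hu
  rw [eq_mul_inv_iff_mul_eq₀ (mul_ne_zero (gain_ne_zero hu) h0)]
  linear_combination p.beta * factorInvCoeff_mul hu ω - (ejω ω + p.gain * p.Abar) * h1 - h2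

lemma factor_inv (hu : p.StabilizableU) {ω : Freq} (hω : ejω ω ≠ p.a) :
    (p.factor ω)⁻¹ = 1 + p.factorInvCoeff ω • vecMulVec p.BuC p.BuC := by
  refine Matrix.inv_eq_right_inv ?_
  have h0 := sub_ne_zero.2 hω
  have h3 := ejω_sub_ne_zero (abs_Abar_lt_one hu) ω
  have h2 : (p.gain : ℂ) ^ 2 * p.Abar = p.a := by exact_mod_cast gain_sq_mul_Abar hu
  have hr := gain_ne_zero hu
  have key : p.factorCoeff ω + p.factorInvCoeff ω
      + p.factorCoeff ω * p.factorInvCoeff ω * (p.BuC ⬝ᵥ p.BuC) = 0 := by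
    rw [BuC_dotProduct]
    have h4 : p.factorCoeff ω * (1 + p.factorInvCoeff ω * p.beta) + p.factorInvCoeff ω = 0 := by
      rw [one_add_factorInvCoeff hu]
      have h5 : (p.gain * (ejω ω - p.Abar)) *
          (p.factorCoeff ω * ((ejω ω - p.a) * (p.gain * (ejω ω - p.Abar))⁻¹)
            + p.factorInvCoeff ω) = 0 := by
        rw [← mul_assoc (p.factorCoeff ω), factorCoeff_mul hω, mul_add, mul_left_comm,
          mul_inv_cancel₀ (mul_ne_zero hr h3)]
        linear_combination factorInvCoeff_mul hu ω
      exact (mul_eq_zero.1 h5).resolve_left (mul_ne_zero hr h3)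
    linear_combination h4
  rw [factor, one_add_smul_vecMulVec_mul, key, zero_smul, add_zero]

lemma F_eq (p : Plant m) (ω : Freq) : p.F ω = (ejω ω - p.a)⁻¹ • p.BuC := rfl

lemma conjTranspose_factor_mul (hu : p.StabilizableU) {ω : Freq} (hω : ejω ω ≠ p.a) :
    (p.factor ω)ᴴ * p.factor ω = 1 + vecMulVec (star (p.F ω)) (p.F ω) := by
  have hstar : star p.BuC = p.BuC := by
    ext i
    exact Complex.conj_ofReal _
  have h0 := sub_ne_zero.2 hω
  have h0' : (ejω ω)⁻¹ - (p.a : ℂ) ≠ 0 := by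
    have := (map_ne_zero (starRingEnd ℂ)).2 h0
    rwa [map_sub, conj_ejω, Complex.conj_ofReal] at this
  have hk : conj (p.factorCoeff ω) * ((ejω ω)⁻¹ - p.a)
      = p.factorGain * ((ejω ω)⁻¹ + p.gain * p.Abar) := by
    have := congrArg (starRingEnd ℂ) (factorCoeff_mul (p := p) hω)
    simpa only [map_mul, map_sub, map_add, conj_ejω, Complex.conj_ofReal] using this
  rw [factor, conjTranspose_add, conjTranspose_one, conjTranspose_smul, conjTranspose_vecMulVec,
    hstar, one_add_smul_vecMulVec_mul, F_eq, star_smul, hstar, vecMulVec_smul, smul_vecMulVec,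
    smul_smul, BuC_dotProduct]
  congr 2
  simp only [RCLike.star_def, map_inv₀, map_sub, conj_ejω, Complex.conj_ofReal]
  rw [← mul_inv, ← mul_eq_one_iff_eq_inv₀ (mul_ne_zero h0 h0')]
  have h1 : (p.factorGain : ℂ) * p.beta = p.gain - 1 := by exact_mod_cast factorGain_mul_beta hu
  have h2 : (p.gain : ℂ) ^ 2 * p.Abar = p.a := by exact_mod_cast gain_sq_mul_Abar hu
  have h3 : (p.factorGain : ℂ) * (p.gain + 1) = p.P := by exact_mod_cast factorGain_mul hu
  have h4 : (p.P : ℂ) * (1 - p.a * p.Abar) = 1 := by exact_mod_cast P_mul_one_sub hu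
  have h5 := mul_inv_cancel₀ (ejω_ne_zero ω)
  have h6 := factorCoeff_mul (p := p) hω
  generalize (ejω ω)⁻¹ = y at *
  generalize ejω ω = z at *
  generalize p.factorCoeff ω = u at *
  have h7 : (conj u + u + conj u * u * p.beta) * ((z - p.a) * (y - p.a))
      = p.factorGain * ((y + p.gain * p.Abar) * (z - p.a) + (z + p.gain * p.Abar) * (y - p.a)
        + (p.gain - 1) * ((y + p.gain * p.Abar) * (z + p.gain * p.Abar))) := by
    linear_combination (z - p.a + p.beta * (u * (z - p.a))) * hk
      + (y - p.a + p.beta * p.factorGain * (y + p.gain * p.Abar)) * h6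
      + p.factorGain * (y + p.gain * p.Abar) * (z + p.gain * p.Abar) * h1
  rw [h7]
  linear_combination (1 - p.a * p.Abar) * h3 + h4 + p.factorGain * (1 + p.gain) * h5
    + p.factorGain * (z + y + (p.gain - 1) * p.Abar) * h2

lemma hInf_factorInvCoeff (hu : p.StabilizableU) : HInf p.factorInvCoeff :=
  (((hInf_const 1).add ((hInf_kernel (abs_Abar_lt_one hu)).const_mul _))).const_mul _

lemma vecMul_factor_inv (hu : p.StabilizableU) {ω : Freq} (hω : ejω ω ≠ p.a) :
    vecMul (p.F ω) (p.factor ω)⁻¹ = ((p.gain : ℂ)⁻¹ * (ejω ω - p.Abar)⁻¹) • p.BuC := by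
  have h0 := sub_ne_zero.2 hω
  rw [factor_inv hu hω, F_eq, smul_vecMul, vecMul_add, vecMul_one, vecMul_smul, vecMul_vecMulVec,
    BuC_dotProduct]
  have h1 : p.BuC + p.factorInvCoeff ω • (p.beta : ℂ) • p.BuC
      = (1 + p.factorInvCoeff ω * p.beta) • p.BuC := by
    rw [add_smul, one_smul, smul_smul]
  rw [h1, one_add_factorInvCoeff hu, smul_smul, inv_mul_cancel_left₀ h0, mul_inv]

lemma isPlantFactor_factor (hu : p.StabilizableU) : p.IsPlantFactor p.factor := by
  have hne := ae_ejω_ne (p.a : ℂ)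
  refine ⟨?_, fun i j => ?_, fun j => ?_, ?_⟩
  · filter_upwards [hne] with ω hω
    exact conjTranspose_factor_mul hu hω
  · have h : HInf fun ω => (1 : Matrix (Fin m) (Fin m) ℂ) i j
        + (p.BuC i * p.BuC j) * p.factorInvCoeff ω :=
      (hInf_const _).add ((hInf_factorInvCoeff hu).const_mul _)
    refine h.congr ?_
    filter_upwards [hne] with ω hω
    rw [factor_inv hu hω, Matrix.add_apply, Matrix.smul_apply, vecMulVec_apply, smul_eq_mul]
    ring
  · have h : HInf fun ω => ((p.gain : ℂ)⁻¹ * p.BuC j) * (ejω ω - p.Abar)⁻¹ :=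
      (hInf_kernel (abs_Abar_lt_one hu)).const_mul _
    refine h.congr ?_
    filter_upwards [hne] with ω hω
    rw [vecMul_factor_inv hu hω, Pi.smul_apply, smul_eq_mul]
    ring
  · refine ⟨fun _ => 1 + (p.factorGain : ℂ) • vecMulVec p.BuC p.BuC,
      fun _ => (p.factorGain * (p.a + p.gain * p.Abar) : ℂ) • p.BuC,
      fun i j => hInf_const _, fun i => hInf_const _, .of_forall fun ω => ?_⟩
    rw [factor, F_eq, smul_vecMulVec, vecMulVec_smul, smul_smul, add_assoc, ← add_smul,
      factorCoeff]
    congr 2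
    ring

/-- The quotient of two plant factors is in `H_∞`. -/
lemma IsPlantFactor.hInf_mul_inv {Δ₁ Δ₂ : Freq → Matrix (Fin m) (Fin m) ℂ}
    (h₁ : p.IsPlantFactor Δ₁) (h₂ : p.IsPlantFactor Δ₂) (i j : Fin m) :
    HInf fun ω => (Δ₁ ω * (Δ₂ ω)⁻¹) i j := by
  obtain ⟨X, Y, hX, hY, hXY⟩ := h₁.2.2.2
  have h : HInf fun ω => ∑ k, X ω i k * (Δ₂ ω)⁻¹ k j + Y ω i * vecMul (p.F ω) (Δ₂ ω)⁻¹ j :=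
    (HInf.sum _ fun k _ => (hX i k).mul (h₂.2.1 k j)).add ((hY i).mul (h₂.2.2.1 j))
  refine h.congr ?_
  filter_upwards [hXY] with ω hω
  rw [hω, Matrix.add_mul, vecMulVec_mul, Matrix.add_apply, mul_apply, vecMulVec_apply]

/-- Plant factors are unique up to a constant unitary matrix. -/
lemma IsPlantFactor.exists_unitary {Δ₁ Δ₂ : Freq → Matrix (Fin m) (Fin m) ℂ}
    (h₁ : p.IsPlantFactor Δ₁) (h₂ : p.IsPlantFactor Δ₂) :
    ∃ U : Matrix (Fin m) (Fin m) ℂ, Uᴴ * U = 1 ∧ ∀ᵐ ω ∂dω, Δ₁ ω = U * Δ₂ ω := by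
  have hadj : ∀ᵐ ω ∂dω, (Δ₁ ω * (Δ₂ ω)⁻¹)ᴴ = Δ₂ ω * (Δ₁ ω)⁻¹ := by
    filter_upwards [h₁.1, h₂.1] with ω a b
    exact conjTranspose_mul_inv_eq (a.trans b.symm) (isUnit_det_of_conjTranspose_mul a)
      (isUnit_det_of_conjTranspose_mul b)
  have hconst : ∀ i j, ∃ k, ∀ᵐ ω ∂dω, (Δ₁ ω * (Δ₂ ω)⁻¹) i j = k := by
    intro i j
    refine ae_eq_const_of_causal_conj ((h₁.hInf_mul_inv h₂ i j).memLp 2)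
      (h₁.hInf_mul_inv h₂ i j).2 ((h₂.hInf_mul_inv h₁ j i).2.congr ?_)
    filter_upwards [hadj] with ω hω
    rw [← hω, conjTranspose_apply, RCLike.star_def]
  choose U hU using hconst
  have hU' : ∀ᵐ ω ∂dω, Δ₁ ω * (Δ₂ ω)⁻¹ = of U := by
    have : ∀ᵐ ω ∂dω, ∀ i j, (Δ₁ ω * (Δ₂ ω)⁻¹) i j = U i j :=
      ae_all_iff.2 fun i => ae_all_iff.2 fun j => hU i j
    filter_upwards [this] with ω hω
    ext i j
    exact hω i j
  refine ⟨of U, ?_, ?_⟩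
  · obtain ⟨ω, hω, ha, a, b⟩ := (hU'.and (hadj.and (h₁.1.and h₂.1))).exists
    have hA := isUnit_det_of_conjTranspose_mul a
    have hB := isUnit_det_of_conjTranspose_mul b
    rw [← hω, ha, Matrix.mul_assoc, ← Matrix.mul_assoc (Δ₁ ω)⁻¹, nonsing_inv_mul _ hA,
      Matrix.one_mul, mul_nonsing_inv _ hB]
  · filter_upwards [hU', h₂.1] with ω hω b
    rw [← hω, Matrix.mul_assoc, nonsing_inv_mul _ (isUnit_det_of_conjTranspose_mul b),
      Matrix.mul_one]

/-! ### Parametrization of the admissible controllers -/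

/-- The anticausal part of `Δ K_∘`. -/
def anticausalPart (p : Plant m) (ω : Freq) : Fin m → ℂ :=
  fun i => p.Cbar i * p.Dbar * ((ejω ω)⁻¹ - p.Abar)⁻¹

lemma factor_mulVec (p : Plant m) (ω : Freq) (v : Fin m → ℂ) :
    p.factor ω *ᵥ v = v + (p.factorCoeff ω * (p.BuC ⬝ᵥ v)) • p.BuC :=
  one_add_smul_vecMulVec_mulVec _ _ _ _

/-- A partial fraction decomposition. The second term has its pole at `a`, so it need not be causal
when `|a| ≥ 1`; it is combined with the pole of `Δ K` later. -/
lemma factor_mulVec_Knc (hu : p.StabilizableU) {ω : Freq} (hω : ejω ω ≠ p.a) :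
    p.factor ω *ᵥ p.Knc ω = p.anticausalPart ω
      - (p.bw * p.P / p.gain * (1 + p.a * (ejω ω - p.a)⁻¹) : ℂ) • p.BuC := by
  have h0 := sub_ne_zero.2 hω
  have h0' : (ejω ω)⁻¹ - (p.a : ℂ) ≠ 0 := by
    have := (map_ne_zero (starRingEnd ℂ)).2 h0
    rwa [map_sub, conj_ejω, Complex.conj_ofReal] at this
  have hc := abs_Abar_lt_one hu
  have h3 := ejω_sub_ne_zero hc ω
  have h3' := inv_ejω_sub_ne_zero hc ω
  have hr := gain_ne_zero hu
  have hg : ((‖(ejω ω - p.a)⁻¹‖ ^ 2 : ℝ) : ℂ) = ((ejω ω - p.a) * ((ejω ω)⁻¹ - p.a))⁻¹ := by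
    push_cast
    rw [← Complex.mul_conj', map_inv₀, map_sub, conj_ejω, Complex.conj_ofReal, mul_inv]
  have hK : p.Knc ω = (-(p.bw * ((p.gain : ℂ) ^ 2 * ((ejω ω - p.Abar) * ((ejω ω)⁻¹ - p.Abar)))⁻¹))
      • p.BuC := by
    ext i
    rw [Knc_eq]
    push_cast at hg ⊢
    rw [hg, spectral_identity hu, Pi.smul_apply, smul_eq_mul, BuC]
    have h5 : (ejω ω - p.a) * ((ejω ω)⁻¹ - p.a) + (p.beta : ℂ) ≠ 0 := by
      rw [← spectral_identity hu]
      exact mul_ne_zero (pow_ne_zero _ hr) (mul_ne_zero h3 h3')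
    have h6 : (1 : ℂ) + p.beta * ((ejω ω - p.a) * ((ejω ω)⁻¹ - p.a))⁻¹
        = ((ejω ω - p.a) * ((ejω ω)⁻¹ - p.a) + p.beta)
          * ((ejω ω - p.a) * ((ejω ω)⁻¹ - p.a))⁻¹ := by
      rw [add_mul, mul_inv_cancel₀ (mul_ne_zero h0 h0')]
    rw [h6, mul_div_mul_right _ _ (inv_ne_zero (mul_ne_zero h0 h0')), div_eq_mul_inv]
    ring
  have h4 : (p.P : ℂ) * (1 - p.a * p.Abar) = 1 := by exact_mod_cast P_mul_one_sub hu
  have h5 := mul_inv_cancel₀ (ejω_ne_zero ω)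
  have hA : p.anticausalPart ω
      = (-((p.gain : ℂ)⁻¹ * (p.Abar * p.P * p.bw) * ((ejω ω)⁻¹ - p.Abar)⁻¹)) • p.BuC := by
    ext i
    rw [anticausalPart, Cbar_eq hu, Dbar, Pi.smul_apply, smul_eq_mul, BuC]
    simp only [Pi.neg_apply, Pi.smul_apply, smul_eq_mul]
    push_cast
    ring
  rw [factor_mulVec, hK, hA, dotProduct_smul, BuC_dotProduct, ← add_smul, ← sub_smul]
  congr 1
  simp only [smul_eq_mul]
  have h7 : ∀ x : ℂ, x + p.factorCoeff ω * (x * p.beta) = (1 + p.factorCoeff ω * p.beta) * x := by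
    intro x; ring
  rw [h7, one_add_factorCoeff hu hω]
  generalize (ejω ω)⁻¹ = y at *
  generalize ejω ω = z at *
  have h8 : (p.Abar : ℂ) * p.P * (z - p.a) + p.P * (y - p.Abar) * z = 1 := by
    linear_combination h4 + p.P * h5
  field_simp
  linear_combination p.bw * h8

/-- The poles at `a` of `Δ K_∘` and of `Δ K` have matching coefficients and combine into a multiple
of `F K + G`, which is in `H_∞` by admissibility. -/
lemma exists_param_of_admissible (hu : p.StabilizableU) {K : Freq → Fin m → ℂ}
    (hK : p.Admissible K) : ∃ R : Freq → Fin m → ℂ, (∀ i, HInf fun ω => R ω i) ∧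
      ∀ᵐ ω ∂dω, p.factor ω *ᵥ (p.Knc ω - K ω) = p.anticausalPart ω + R ω := by
  have hb : HInf fun ω => p.BuC ⬝ᵥ K ω :=
    HInf.sum _ fun k _ => (hK.1 k).const_mul (p.BuC k)
  refine ⟨fun ω i => p.BuC i * (-(p.bw * p.P / p.gain : ℂ)) - K ω i
    - (p.factorGain * p.BuC i) * (p.BuC ⬝ᵥ K ω)
    - (p.P * p.gain * p.Abar * p.BuC i) * (p.F ω ⬝ᵥ K ω + p.G ω), fun i => ?_, ?_⟩
  · exact (((hInf_const _).sub (hK.1 i)).sub (hb.const_mul _)).sub (hK.2.const_mul _)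
  · filter_upwards [ae_ejω_ne (p.a : ℂ)] with ω hω
    have hr := gain_ne_zero hu
    have h2 : (p.gain : ℂ) ^ 2 * p.Abar = p.a := by exact_mod_cast gain_sq_mul_Abar hu
    have h3 : (p.factorGain : ℂ) * (p.gain + 1) = p.P := by exact_mod_cast factorGain_mul hu
    have h4 : (p.P : ℂ) / p.gain * p.a = p.P * p.gain * p.Abar := by
      rw [← h2]
      field_simp
    have h5 : (p.factorGain : ℂ) * (p.a + p.gain * p.Abar) = p.P * p.gain * p.Abar := by
      rw [← h2, ← h3]
      ring
    rw [mulVec_sub, factor_mulVec_Knc hu hω, factor_mulVec, factorCoeff, F_eq, smul_dotProduct, G]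
    ext i
    simp only [Pi.sub_apply, Pi.add_apply, Pi.smul_apply, smul_eq_mul]
    linear_combination -(p.bw * (ejω ω - p.a)⁻¹ * p.BuC i) * h4
      - ((ejω ω - p.a)⁻¹ * (p.BuC ⬝ᵥ K ω) * p.BuC i) * h5

lemma exists_admissible_of_param (hu : p.StabilizableU) {R : Freq → Fin m → ℂ}
    (hR : ∀ i, HInf fun ω => R ω i) : ∃ K, p.Admissible K ∧
      ∀ᵐ ω ∂dω, p.factor ω *ᵥ (p.Knc ω - K ω) = p.anticausalPart ω + R ω := by
  have hb : HInf fun ω => p.BuC ⬝ᵥ R ω :=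
    HInf.sum _ fun k _ => (hR k).const_mul (p.BuC k)
  have hker := hInf_kernel (abs_Abar_lt_one hu)
  have hr := gain_ne_zero hu
  -- This is `-Δ⁻¹ R` plus `Δ⁻¹` applied to the term of `Δ K_∘` with the pole at `a`; the zero of
  -- `Δ⁻¹` at `a` cancels that pole.
  set K : Freq → Fin m → ℂ := fun ω i => -(R ω i + p.BuC i * (p.factorInvCoeff ω * (p.BuC ⬝ᵥ R ω)))
    + (-(p.bw * p.P / p.gain ^ 2) * p.BuC i : ℂ) * (1 + p.Abar * (ejω ω - p.Abar)⁻¹) with hKdef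
  have hKv : ∀ ω, K ω = -(R ω + (p.factorInvCoeff ω * (p.BuC ⬝ᵥ R ω)) • p.BuC)
      + (-(p.bw * p.P / p.gain ^ 2) * (1 + p.Abar * (ejω ω - p.Abar)⁻¹) : ℂ) • p.BuC := by
    intro ω
    ext i
    simp only [hKdef, Pi.add_apply, Pi.neg_apply, Pi.smul_apply, smul_eq_mul]
    ring
  have hP : (p.P : ℂ) * p.beta = p.gain ^ 2 - 1 := by
    have := gain_sq hu
    have h : p.P * p.beta = p.gain ^ 2 - 1 := by linarith
    exact_mod_cast h
  refine ⟨K, ⟨fun i => ?_, ?_⟩, ?_⟩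
  · exact (((hR i).add (((hInf_factorInvCoeff hu).mul hb).const_mul _)).neg).add
      (((hInf_const 1).add (hker.const_mul _)).const_mul _)
  · have h : HInf fun ω => (-(p.gain : ℂ)⁻¹) * ((ejω ω - p.Abar)⁻¹ * (p.BuC ⬝ᵥ R ω))
        + (p.bw * ((p.gain : ℂ) ^ 2)⁻¹) * (ejω ω - p.Abar)⁻¹ :=
      ((hker.mul hb).const_mul _).add (hker.const_mul _)
    refine h.congr ?_
    filter_upwards [ae_ejω_ne (p.a : ℂ)] with ω hω
    have h0 := sub_ne_zero.2 hω
    have h3 := ejω_sub_ne_zero (abs_Abar_lt_one hu) ω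
    have h2 : (p.gain : ℂ) ^ 2 * p.Abar = p.a := by exact_mod_cast gain_sq_mul_Abar hu
    have h5 := one_add_factorInvCoeff hu ω
    rw [F_eq, smul_dotProduct, G, hKv, dotProduct_add, dotProduct_neg, dotProduct_add,
      dotProduct_smul, dotProduct_smul, BuC_dotProduct]
    simp only [smul_eq_mul]
    have h6 : (p.BuC ⬝ᵥ R ω) + p.factorInvCoeff ω * (p.BuC ⬝ᵥ R ω) * p.beta
        = (ejω ω - p.a) * (p.gain * (ejω ω - p.Abar))⁻¹ * (p.BuC ⬝ᵥ R ω) := by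
      rw [← h5]; ring
    rw [h6]
    generalize p.BuC ⬝ᵥ R ω = ρ
    -- The factor `z - a` obtained here cancels the plant pole in `F K + G`, so the closed loop is
    -- bounded and causal even for an unstable plant.
    have h7 : (-(p.bw * p.P / p.gain ^ 2) * (1 + p.Abar * (ejω ω - p.Abar)⁻¹) * p.beta + p.bw : ℂ)
        = p.bw * ((p.gain : ℂ) ^ 2)⁻¹ * (ejω ω - p.Abar)⁻¹ * (ejω ω - p.a) := by
      field_simp
      linear_combination -(p.bw * ejω ω) * hP - p.bw * h2
    have h8 : (ejω ω - p.a : ℂ)⁻¹ * (-((ejω ω - p.a) * (p.gain * (ejω ω - p.Abar))⁻¹ * ρ)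
        + -(p.bw * p.P / p.gain ^ 2) * (1 + p.Abar * (ejω ω - p.Abar)⁻¹) * p.beta)
        + (ejω ω - p.a)⁻¹ * p.bw = (ejω ω - p.a : ℂ)⁻¹ * (-((ejω ω - p.a)
          * (p.gain * (ejω ω - p.Abar))⁻¹ * ρ)
        + (-(p.bw * p.P / p.gain ^ 2) * (1 + p.Abar * (ejω ω - p.Abar)⁻¹) * p.beta + p.bw)) := by
      ring
    rw [h8, h7]
    field_simp
  · filter_upwards [ae_ejω_ne (p.a : ℂ)] with ω hω
    have h0 := sub_ne_zero.2 hω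
    have h3 := ejω_sub_ne_zero (abs_Abar_lt_one hu) ω
    have hinv : p.factor ω *ᵥ (R ω + (p.factorInvCoeff ω * (p.BuC ⬝ᵥ R ω)) • p.BuC) = R ω := by
      have h := one_add_smul_vecMulVec_mulVec p.BuC p.BuC (p.factorInvCoeff ω) (R ω)
      rw [← factor_inv hu hω] at h
      rw [← h, mulVec_mulVec, mul_nonsing_inv _
        (isUnit_det_of_conjTranspose_mul (conjTranspose_factor_mul hu hω)), one_mulVec]
    have hB : p.factor ω *ᵥ p.BuC = (p.gain * (ejω ω - p.Abar) * (ejω ω - p.a)⁻¹) • p.BuC := by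
      rw [factor_mulVec, BuC_dotProduct, ← one_add_factorCoeff hu hω, add_smul, one_smul]
    rw [mulVec_sub, factor_mulVec_Knc hu hω, hKv, mulVec_add, mulVec_neg, hinv, mulVec_smul, hB,
      smul_smul]
    have : (-(p.bw * p.P / p.gain ^ 2) * (1 + p.Abar * (ejω ω - p.Abar)⁻¹)
        * (p.gain * (ejω ω - p.Abar) * (ejω ω - p.a)⁻¹) : ℂ)
        = -(p.bw * p.P / p.gain * (1 + p.a * (ejω ω - p.a)⁻¹)) := by
      field_simp
      ring
    rw [this, neg_smul]
    abel

end Plant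

/-! ### Monotone subhomogeneous maps -/

/-- Monotonicity traps the iterates between `0` and `b`, so they increase to some `s`, and `s ≤ Φ s`
follows. No continuity of `Φ` is assumed: subhomogeneity supplies the other inequality from the
left. -/
lemma tendsto_iterate_of_subhomogeneous {Φ : ℝ → ℝ} (h0 : ∀ s, 0 ≤ Φ s)
    (hmono : ∀ s t, 0 ≤ s → s ≤ t → Φ s ≤ Φ t)
    (hsub : ∀ s t, 0 ≤ s → 1 ≤ t → Φ (t * s) ≤ t * Φ s)
    {b : ℝ} (hb : 0 ≤ b) (hΦb : Φ b ≤ b) {x : ℕ → ℝ} (hx0 : x 0 = 0)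
    (hx : ∀ n, x (n + 1) = Φ (x n)) :
    Monotone x ∧ (∀ n, 0 ≤ x n) ∧ ∃ s, 0 ≤ s ∧ Φ s = s ∧ Tendsto x atTop (𝓝 s) := by
  have hnn : ∀ n, 0 ≤ x n := by
    intro n
    cases n with
    | zero => rw [hx0]
    | succ n => rw [hx]; exact h0 _
  have hm : Monotone x := by
    refine monotone_nat_of_le_succ fun n => ?_
    induction n with
    | zero => rw [hx0]; exact hnn 1
    | succ n ih => rw [hx (n + 1)]; nth_rw 1 [hx n]; exact hmono _ _ (hnn n) ih
  have hle : ∀ n, x n ≤ b := by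
    intro n
    induction n with
    | zero => rwa [hx0]
    | succ n ih => rw [hx]; exact (hmono _ _ (hnn n) ih).trans hΦb
  obtain ⟨s, hs⟩ : ∃ s, Tendsto x atTop (𝓝 s) :=
    ⟨_, tendsto_atTop_ciSup hm ⟨b, by rintro _ ⟨n, rfl⟩; exact hle n⟩⟩
  have hxs : ∀ n, x n ≤ s := fun n => hm.ge_of_tendsto hs n
  have hs0 : 0 ≤ s := (hnn 0).trans (hxs 0)
  have hs' : Tendsto (fun n => x (n + 1)) atTop (𝓝 s) := (tendsto_add_atTop_iff_nat 1).2 hs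
  refine ⟨hm, hnn, s, hs0, le_antisymm ?_ ?_, hs⟩
  · rcases hs0.eq_or_lt with h | h
    · have : x 0 = s := le_antisymm (hxs 0) (by rw [← h]; exact hnn 0)
      rw [← this, ← hx]
      exact (hxs 1).trans this.ge
    · have hpos : ∀ᶠ n in atTop, 0 < x n := hs.eventually (lt_mem_nhds h)
      -- Scaling `x n` up to `s` gives `Φ s ≤ (s / x n) Φ (x n)`, and the right side tends to `s`.
      have hlim : Tendsto (fun n => s / x n * x (n + 1)) atTop (𝓝 (s / s * s)) :=
        ((tendsto_const_nhds (x := s)).div hs h.ne').mul hs'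
      rw [div_self h.ne', one_mul] at hlim
      refine ge_of_tendsto hlim ?_
      filter_upwards [hpos] with n hn
      have := hsub (x n) (s / x n) (hnn n) ((one_le_div hn).2 (hxs n))
      rwa [div_mul_cancel₀ _ hn.ne', ← hx] at this
  · exact le_of_tendsto' hs' fun n => by rw [hx]; exact hmono _ _ (hnn n) (hxs n)

namespace Plant

variable {m : ℕ} {p : Plant m} {γ : ℝ}

/-! ### Bounds on the non-causal closed loop -/

lemma exists_controller (hγ : p.gammaInf < ENNReal.ofReal γ) :
    ∃ (K : Freq → Fin m → ℂ) (γ' : ℝ), p.Admissible K ∧ 0 ≤ γ' ∧ γ' < γ ∧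
      ∀ᵐ ω ∂dω, ‖p.closedLoop K ω‖ ≤ γ' := by
  obtain ⟨K, hK⟩ := iInf_lt_iff.1 hγ
  obtain ⟨hadm, hlt⟩ := iInf_lt_iff.1 hK
  refine ⟨K, (eLpNorm (p.closedLoop K) ∞ dω).toReal, hadm, ENNReal.toReal_nonneg, ?_, ?_⟩
  · exact (ENNReal.lt_ofReal_iff_toReal_lt hlt.ne_top).1 hlt
  · rw [eLpNorm_exponent_top] at hlt ⊢
    filter_upwards [ae_le_eLpNormEssSup (f := p.closedLoop K) (μ := dω)] with ω hω
    have := ENNReal.toReal_mono hlt.ne_top hω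
    simpa using this

lemma Tnc_nonneg (p : Plant m) (ω : Freq) : 0 ≤ p.Tnc ω := sq_nonneg _

lemma measurable_Tnc (p : Plant m) : Measurable p.Tnc := by
  have h : p.Tnc = fun ω => p.bw ^ 2 * ‖(ejω ω - p.a)⁻¹‖ ^ 2
      / (1 + p.beta * ‖(ejω ω - p.a)⁻¹‖ ^ 2) := funext (Tnc_eq p)
  have h1 : Measurable fun ω => ‖(ejω ω - p.a)⁻¹‖ ^ 2 :=
    ((continuous_ejω.measurable.sub_const _).inv.norm).pow_const 2
  rw [h]
  exact (h1.const_mul _).div ((h1.const_mul _).const_add _)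

lemma gain_sq_mul_norm_sq (hu : p.StabilizableU) (ω : Freq) :
    p.gain ^ 2 * ‖ejω ω - p.Abar‖ ^ 2 = ‖ejω ω - p.a‖ ^ 2 + p.beta := by
  have h := spectral_identity hu ω
  have hn : ∀ x : ℝ, (ejω ω - x) * ((ejω ω)⁻¹ - x) = ((‖ejω ω - x‖ ^ 2 : ℝ) : ℂ) := by
    intro x
    push_cast
    rw [← Complex.mul_conj', map_sub, conj_ejω, Complex.conj_ofReal]
  rw [hn, hn] at h
  exact_mod_cast h

/-- Off a possible pole `z = a`, the function is the continuous `b_w² / (r² |z - Ā|²)`, with `r` the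
gain; at the pole its default value `0` lies below. Hence an almost-everywhere bound holds at every
frequency. -/
lemma Tnc_le_of_ae (hu : p.StabilizableU) {x : ℝ} (hx : ∀ᵐ ω ∂dω, p.Tnc ω ≤ x) (ω : Freq) :
    p.Tnc ω ≤ x := by
  set T : Freq → ℝ := fun ω => p.bw ^ 2 / (p.gain ^ 2 * ‖ejω ω - p.Abar‖ ^ 2) with hT
  have hpos : ∀ ω, 0 < p.gain ^ 2 * ‖ejω ω - p.Abar‖ ^ 2 := fun ω => by
    have := gain_pos hu
    have := norm_pos_iff.2 (ejω_sub_ne_zero (abs_Abar_lt_one hu) ω)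
    positivity
  have hTc : Continuous T := continuous_const.div (by fun_prop) fun ω => (hpos ω).ne'
  have heq : ∀ ω, ejω ω ≠ p.a → p.Tnc ω = T ω := by
    intro ω hω
    have h1 := norm_pos_iff.2 (sub_ne_zero.2 hω)
    have h2 := p.beta_nonneg
    rw [Tnc_eq, hT]
    simp only [gain_sq_mul_norm_sq hu, norm_inv]
    field_simp
  have hle : ∀ ω, p.Tnc ω ≤ T ω := by
    intro ω
    by_cases hω : ejω ω = p.a
    · rw [Tnc_eq, hω]
      have := (hpos ω).le
      simp only [sub_self, _root_.inv_zero, norm_zero]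
      rw [zero_pow two_ne_zero, mul_zero, zero_div]
      positivity
    · exact (heq ω hω).le
  have hTx : ∀ᵐ ω ∂dω, T ω ≤ x := by
    filter_upwards [hx, ae_ejω_ne (p.a : ℂ)] with ω h1 h2
    rwa [← heq ω h2]
  have hmin : (fun ω => min (T ω) x) = T :=
    Continuous.ae_eq_iff_eq dω (hTc.min continuous_const) hTc |>.1 (by
      filter_upwards [hTx] with ω hω
      exact min_eq_left hω)
  exact (hle ω).trans (by rw [← hmin]; exact min_le_right _ _)

lemma exists_gap (hu : p.StabilizableU) (hγ : p.gammaInf < ENNReal.ofReal γ) :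
    ∃ (K : Freq → Fin m → ℂ) (γ' : ℝ), p.Admissible K ∧ 0 ≤ γ' ∧ γ' < γ ∧
      (∀ᵐ ω ∂dω, ‖p.closedLoop K ω‖ ≤ γ') ∧ ∀ ω, p.Tnc ω ≤ γ' ^ 2 := by
  obtain ⟨K, γ', hK, h0, h1, h2⟩ := exists_controller hγ
  refine ⟨K, γ', hK, h0, h1, h2, Tnc_le_of_ae hu ?_⟩
  filter_upwards [h2, ae_ejω_ne (p.a : ℂ)] with ω hω hne
  have h := norm_closedLoop_sq_eq p K ω (conjTranspose_factor_mul hu hne)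
  have h3 : 0 ≤ ∑ i, ‖(p.factor ω *ᵥ (p.Knc ω - K ω)) i‖ ^ 2 := by positivity
  have h4 := pow_le_pow_left₀ (norm_nonneg _) hω 2
  linarith

lemma Tnc_lt (hu : p.StabilizableU) (hγ : p.gammaInf < ENNReal.ofReal γ) (ω : Freq) :
    p.Tnc ω < γ ^ 2 := by
  obtain ⟨_, γ', _, h0, h1, _, h2⟩ := exists_gap hu hγ
  exact (h2 ω).trans_lt (pow_lt_pow_left₀ h1 h0 two_ne_zero)

/-! ### The spectra of the iteration -/

/-- The spectrum `S* S / (γ² - T_{K_∘}* T_{K_∘})` of the iteration for `|B̄| = 1`. -/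
def weight (p : Plant m) (γ : ℝ) (ω : Freq) : ℝ :=
  (∑ i, p.Cbar i ^ 2) * (‖ejω ω - p.Abar‖ ^ 2)⁻¹ / (γ ^ 2 - p.Tnc ω)

/-- The spectrum of the iteration for `|B̄|² = s`. -/
def spectrumOf (p : Plant m) (γ s : ℝ) (ω : Freq) : ℝ := max (s * p.weight γ ω) 1

lemma sum_norm_F1_sq (p : Plant m) (B : ℂ) (ω : Freq) :
    ∑ i, ‖p.F1 B ω i‖ ^ 2 = ‖B‖ ^ 2 * ((∑ i, p.Cbar i ^ 2) * (‖ejω ω - p.Abar‖ ^ 2)⁻¹) := by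
  simp only [F1, norm_mul, norm_inv, norm_inv_ejω_sub, mul_pow, inv_pow, Complex.norm_real,
    Real.norm_eq_abs, sq_abs]
  rw [← Finset.sum_mul, ← Finset.sum_mul]
  ring

lemma F2_F1 (p : Plant m) (γ : ℝ) (B : ℂ) : p.F2 γ (p.F1 B) = p.spectrumOf γ (‖B‖ ^ 2) := by
  ext ω
  rw [F2, sum_norm_F1_sq, spectrumOf, weight, mul_div_assoc]

lemma weight_nonneg (hT : ∀ ω, p.Tnc ω < γ ^ 2) (ω : Freq) : 0 ≤ p.weight γ ω := by
  have := sub_pos.2 (hT ω)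
  unfold weight
  positivity

lemma measurable_weight (p : Plant m) (γ : ℝ) : Measurable (p.weight γ) := by
  unfold weight
  have h : Measurable fun ω => ‖ejω ω - (p.Abar : ℂ)‖ ^ 2 :=
    ((continuous_ejω.measurable.sub_const _).norm).pow_const 2
  exact (h.inv.const_mul _).div (measurable_const.sub p.measurable_Tnc)

lemma exists_weight_le (hu : p.StabilizableU) (hγ : p.gammaInf < ENNReal.ofReal γ) :
    ∃ W, ∀ ω, p.weight γ ω ≤ W := by
  obtain ⟨_, γ', _, h0, h1, _, h2⟩ := exists_gap hu hγ
  have hgap : 0 < γ ^ 2 - γ' ^ 2 := sub_pos.2 (pow_lt_pow_left₀ h1 h0 two_ne_zero)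
  have hc : Continuous fun ω => (∑ i, p.Cbar i ^ 2) * (‖ejω ω - p.Abar‖ ^ 2)⁻¹ := by
    refine continuous_const.mul (Continuous.inv₀ (by fun_prop) fun ω => ?_)
    exact pow_ne_zero _ (norm_ne_zero_iff.2 (ejω_sub_ne_zero (abs_Abar_lt_one hu) ω))
  obtain ⟨M, hM⟩ := (isCompact_range hc).bddAbove
  refine ⟨M / (γ ^ 2 - γ' ^ 2), fun ω => ?_⟩
  have hM' := hM ⟨ω, rfl⟩
  have hnn : 0 ≤ (∑ i, p.Cbar i ^ 2) * (‖ejω ω - p.Abar‖ ^ 2)⁻¹ := by positivity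
  exact div_le_div₀ (hnn.trans hM') hM' hgap (by linarith [h2 ω])

lemma exists_isSpectralFactor_spectrumOf (hu : p.StabilizableU)
    (hγ : p.gammaInf < ENNReal.ofReal γ) {s : ℝ} (hs : 0 ≤ s) :
    IsSpectralFactor (p.spectrumOf γ s) (spectralFactor (p.spectrumOf γ s)) := by
  obtain ⟨W, hW⟩ := exists_weight_le hu hγ
  refine Classical.epsilon_spec (exists_isSpectralFactor (M := max (s * W) 1)
    (((measurable_weight p γ).const_mul s).max measurable_const) (fun ω => le_max_right _ _)
    fun ω => max_le_max (mul_le_mul_of_nonneg_left (hW ω) hs) le_rfl)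

lemma spectrumOf_pos (p : Plant m) (γ s : ℝ) (ω : Freq) : 0 < p.spectrumOf γ s ω :=
  one_pos.trans_le (le_max_right _ _)

/-! ### The dual map `|B̄|² ↦ |F₄ (F₃ (F₂ (F₁ B̄)))|²` -/

/-- The iteration in terms of `s = |B̄|²`. -/
def dualMap (p : Plant m) (γ s : ℝ) : ℝ :=
  p.Dbar ^ 2 * ‖evalAt p.Abar (spectralFactor (p.spectrumOf γ s))‖ ^ 2

lemma F4_eq (p : Plant m) (L : Freq → ℂ) : p.F4 L = p.Dbar * evalAt p.Abar L := by
  rw [F4, evalAt, ← integral_const_mul]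
  congr 1 with ω
  ring

lemma norm_F4_sq (p : Plant m) (L : Freq → ℂ) :
    ‖p.F4 L‖ ^ 2 = p.Dbar ^ 2 * ‖evalAt p.Abar L‖ ^ 2 := by
  rw [F4_eq, norm_mul, mul_pow, Complex.norm_real, Real.norm_eq_abs, sq_abs]

lemma norm_Biter_succ_sq (p : Plant m) (γ : ℝ) (n : ℕ) :
    ‖p.Biter γ (n + 1)‖ ^ 2 = p.dualMap γ (‖p.Biter γ n‖ ^ 2) := by
  rw [Biter, norm_F4_sq, F2_F1, dualMap]

/-- The comparison of moduli, applied in both directions, makes the value independent of the chosen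
spectral factor, so uniqueness of the factor is not needed. -/
lemma dualMap_eq_of_isSpectralFactor (hu : p.StabilizableU) (hγ : p.gammaInf < ENNReal.ofReal γ)
    {s : ℝ} (hs : 0 ≤ s) {N : Freq → ℝ} {L : Freq → ℂ}
    (hN : N =ᵐ[dω] p.spectrumOf γ s) (hL : IsSpectralFactor N L) :
    p.dualMap γ s = p.Dbar ^ 2 * ‖evalAt p.Abar L‖ ^ 2 := by
  have hc := abs_Abar_lt_one hu
  have h := exists_isSpectralFactor_spectrumOf hu hγ hs
  have hL' := hL.of_ae_eq hN
  have hpos : ∀ᵐ ω ∂dω, 0 < p.spectrumOf γ s ω := .of_forall (p.spectrumOf_pos γ s)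
  have hle : ∀ᵐ ω ∂dω, p.spectrumOf γ s ω ≤ p.spectrumOf γ s ω := .of_forall fun _ => le_rfl
  rw [dualMap, le_antisymm (h.norm_evalAt_le hc hL' hpos hle) (hL'.norm_evalAt_le hc h hpos hle)]

lemma dualMap_mono (hu : p.StabilizableU) (hγ : p.gammaInf < ENNReal.ofReal γ)
    {s t : ℝ} (hs : 0 ≤ s) (hst : s ≤ t) : p.dualMap γ s ≤ p.dualMap γ t := by
  refine mul_le_mul_of_nonneg_left (pow_le_pow_left₀ (norm_nonneg _) ?_ 2) (sq_nonneg _)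
  refine (exists_isSpectralFactor_spectrumOf hu hγ hs).norm_evalAt_le (abs_Abar_lt_one hu)
    (exists_isSpectralFactor_spectrumOf hu hγ (hs.trans hst))
    (.of_forall (p.spectrumOf_pos γ s)) (.of_forall fun ω => ?_)
  exact max_le_max (mul_le_mul_of_nonneg_right hst (weight_nonneg (Tnc_lt hu hγ) ω)) le_rfl

lemma spectrumOf_mul_le (p : Plant m) (γ s : ℝ) {t : ℝ} (ht : 1 ≤ t) (ω : Freq) :
    p.spectrumOf γ (t * s) ω ≤ t * p.spectrumOf γ s ω := by
  rw [spectrumOf, spectrumOf, mul_assoc, mul_max_of_nonneg _ _ (by linarith), mul_one]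
  exact max_le_max le_rfl ht

lemma norm_sqrt_mul_evalAt_sq {t : ℝ} (ht : 0 ≤ t) (c : ℝ) (L : Freq → ℂ) :
    ‖evalAt c (fun ω => (√t : ℂ) * L ω)‖ ^ 2 = t * ‖evalAt c L‖ ^ 2 := by
  rw [evalAt_const_mul, norm_mul, mul_pow, Complex.norm_real, Real.norm_eq_abs, sq_abs,
    Real.sq_sqrt ht]

lemma dualMap_mul_le (hu : p.StabilizableU) (hγ : p.gammaInf < ENNReal.ofReal γ)
    {s t : ℝ} (hs : 0 ≤ s) (ht : 1 ≤ t) :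
    p.dualMap γ (t * s) ≤ t * p.dualMap γ s := by
  have ht0 : 0 < t := by linarith
  rw [dualMap, dualMap, mul_left_comm, ← norm_sqrt_mul_evalAt_sq ht0.le]
  refine mul_le_mul_of_nonneg_left (pow_le_pow_left₀ (norm_nonneg _) ?_ 2) (sq_nonneg _)
  exact (exists_isSpectralFactor_spectrumOf hu hγ (mul_nonneg ht0.le hs)).norm_evalAt_le
    (abs_Abar_lt_one hu) ((exists_isSpectralFactor_spectrumOf hu hγ hs).const_mul ht0)
    (.of_forall (p.spectrumOf_pos γ _)) (.of_forall (p.spectrumOf_mul_le γ s ht))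

/-- If the constraint is active at all frequencies, then the dual map is strictly below the
identity, because the level `γ` is feasible with a margin. -/
lemma dualMap_lt (hu : p.StabilizableU) (hγ : p.gammaInf < ENNReal.ofReal γ)
    {s : ℝ} (hs : ∀ᵐ ω ∂dω, 1 ≤ s * p.weight γ ω) : p.dualMap γ s < s := by
  have hc := abs_Abar_lt_one hu
  have hT := Tnc_lt hu hγ
  obtain ⟨K, γ', hK, h0, h1, h2, h3⟩ := exists_gap hu hγ
  obtain ⟨R, hR, hKR⟩ := exists_param_of_admissible hu hK
  set C := ∑ i, p.Cbar i ^ 2 with hC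
  have hC0' : 0 ≤ C := Finset.sum_nonneg fun i _ => sq_nonneg _
  obtain ⟨hs0, hC0⟩ : 0 < s ∧ 0 < C := by
    obtain ⟨ω, hω⟩ := hs.exists
    have hw := weight_nonneg hT ω
    constructor
    · by_contra hcon
      nlinarith
    · refine lt_of_le_of_ne hC0' fun h => ?_
      rw [weight, ← hC, ← h, zero_mul, zero_div, mul_zero] at hω
      linarith
  have hL := exists_isSpectralFactor_spectrumOf hu hγ hs0.le
  rw [dualMap]
  generalize spectralFactor (p.spectrumOf γ s) = L at hL ⊢
  have hγ0 : 0 < γ := by linarith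
  -- This is `(z⁻¹ - Ā) Δ (K_∘ - K) L`: the factor `z⁻¹ - Ā` clears the anticausal pole, so `V` is
  -- causal, and its value at `Ā` is `C̄ D̄ L(Ā)` because the term with `R` drops out.
  set V : Fin m → Freq → ℂ := fun i ω =>
    (p.Cbar i * p.Dbar + ((ejω ω)⁻¹ - p.Abar) * R ω i) * L ω with hV
  have hcont : Continuous fun ω => (ejω ω)⁻¹ - (p.Abar : ℂ) :=
    continuous_inv_ejω.sub continuous_const
  have hfac : ∀ i, HInf fun ω => p.Cbar i * p.Dbar + ((ejω ω)⁻¹ - p.Abar) * R ω i := by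
    intro i
    have hb : HInf fun ω => (ejω ω)⁻¹ * R ω i :=
      ⟨memLp_continuous_mul continuous_inv_ejω (hR i).1, (hR i).2.inv_ejω_mul⟩
    have h := (hInf_const (p.Cbar i * p.Dbar : ℂ)).add (hb.sub ((hR i).const_mul p.Abar))
    simpa only [sub_mul] using h
  have hVc : ∀ i, Causal (V i) := fun i => (hfac i).2.mul hL.2.1 ((hfac i).memLp 2) hL.1
  have hV2 : ∀ i, MemLp (V i) 2 dω := fun i => hL.1.mul (hfac i).1
  have hVe : ∀ i, evalAt p.Abar (V i) = p.Cbar i * (p.Dbar * evalAt p.Abar L) := by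
    intro i
    rw [hV, evalAt_mul hc (hfac i).2 hL.2.1 ((hfac i).memLp 2) hL.1,
      evalAt_add hc (integrable_const _) (integrable_continuous_mul hcont (hR i).integrable),
      evalAt_const hc, evalAt_inv_ejω_sub_mul hc (hR i).2]
    ring
  have hle : ∀ᵐ ω ∂dω, ∑ i, ‖V i ω‖ ^ 2 ≤ s * C * (γ' ^ 2 / γ ^ 2) := by
    filter_upwards [hKR, h2, hs, hL.2.2.2.2.1, ae_ejω_ne (p.a : ℂ)] with ω a b d e f
    have hsq := norm_closedLoop_sq_eq p K ω (conjTranspose_factor_mul hu f)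
    have hz := inv_ejω_sub_ne_zero hc ω
    have hVQ : ∀ i, V i ω
        = ((ejω ω)⁻¹ - p.Abar) * (p.factor ω *ᵥ (p.Knc ω - K ω)) i * L ω := by
      intro i
      rw [a, hV, Pi.add_apply, anticausalPart]
      have h4 := mul_inv_cancel₀ hz
      linear_combination -(p.Cbar i * p.Dbar * L ω) * h4
    have hsum : ∑ i, ‖V i ω‖ ^ 2 = ‖ejω ω - p.Abar‖ ^ 2
        * (∑ i, ‖(p.factor ω *ᵥ (p.Knc ω - K ω)) i‖ ^ 2) * (s * p.weight γ ω) := by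
      have hN : p.spectrumOf γ s ω = s * p.weight γ ω := max_eq_left d
      rw [← hN, ← e, Finset.mul_sum, Finset.sum_mul]
      refine Finset.sum_congr rfl fun i _ => ?_
      rw [hVQ, norm_mul, norm_mul, norm_inv_ejω_sub, mul_pow, mul_pow]
    have hz' : 0 < ‖ejω ω - (p.Abar : ℂ)‖ := norm_pos_iff.2 (ejω_sub_ne_zero hc ω)
    have hg : 0 < γ ^ 2 - p.Tnc ω := sub_pos.2 (hT ω)
    have hq : ∑ i, ‖(p.factor ω *ᵥ (p.Knc ω - K ω)) i‖ ^ 2 ≤ γ' ^ 2 - p.Tnc ω := by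
      have := pow_le_pow_left₀ (norm_nonneg _) b 2
      linarith
    -- The margin `γ' < γ` becomes a contraction factor `γ'² / γ² < 1` that is uniform in the
    -- frequency.
    have hθ : γ' ^ 2 - p.Tnc ω ≤ γ' ^ 2 / γ ^ 2 * (γ ^ 2 - p.Tnc ω) := by
      have h5 : γ' ^ 2 / γ ^ 2 * γ ^ 2 = γ' ^ 2 := div_mul_cancel₀ _ (by positivity)
      have h6 : γ' ^ 2 / γ ^ 2 ≤ 1 := by
        rw [div_le_one (by positivity)]
        exact pow_le_pow_left₀ h0 h1.le 2
      have := mul_le_mul_of_nonneg_right h6 (p.Tnc_nonneg ω)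
      linarith
    have h7 : ‖ejω ω - p.Abar‖ ^ 2 * (∑ i, ‖(p.factor ω *ᵥ (p.Knc ω - K ω)) i‖ ^ 2)
          * (s * p.weight γ ω)
        = s * C * ((∑ i, ‖(p.factor ω *ᵥ (p.Knc ω - K ω)) i‖ ^ 2) / (γ ^ 2 - p.Tnc ω)) := by
      rw [weight, ← hC]
      field_simp
    rw [hsum, h7]
    refine mul_le_mul_of_nonneg_left ?_ (mul_nonneg hs0.le hC0')
    rw [div_le_iff₀ hg]
    exact hq.trans hθ
  have hint : ∀ i, Integrable (fun ω => poisson p.Abar ω * ‖V i ω‖ ^ 2) dω := fun i =>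
    integrable_poisson_mul hc ((hV2 i).integrable_norm_pow two_ne_zero)
  have hfin : C * (p.Dbar ^ 2 * ‖evalAt p.Abar L‖ ^ 2) ≤ s * C * (γ' ^ 2 / γ ^ 2) := by
    calc C * (p.Dbar ^ 2 * ‖evalAt p.Abar L‖ ^ 2) = ∑ i, ‖evalAt p.Abar (V i)‖ ^ 2 := by
          simp only [hVe, norm_mul, mul_pow, Complex.norm_real, Real.norm_eq_abs, sq_abs]
          rw [← Finset.sum_mul]
      _ ≤ ∑ i, ∫ ω, poisson p.Abar ω * ‖V i ω‖ ^ 2 ∂dω :=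
          Finset.sum_le_sum fun i _ => sq_norm_evalAt_le hc (hVc i) (hV2 i)
      _ = ∫ ω, ∑ i, poisson p.Abar ω * ‖V i ω‖ ^ 2 ∂dω :=
          (integral_finsetSum _ fun i _ => hint i).symm
      _ ≤ ∫ ω, poisson p.Abar ω * (s * C * (γ' ^ 2 / γ ^ 2)) ∂dω := by
          refine integral_mono_ae (integrable_finsetSum _ fun i _ => hint i)
            (integrable_poisson_mul hc (integrable_const _)) ?_
          filter_upwards [hle] with ω hω
          rw [← Finset.mul_sum]
          exact mul_le_mul_of_nonneg_left hω (poisson_pos hc ω).le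
      _ = s * C * (γ' ^ 2 / γ ^ 2) := by
          rw [integral_mul_const, integral_poisson hc, one_mul]
  have hθ1 : γ' ^ 2 / γ ^ 2 < 1 := by
    rw [div_lt_one (by positivity)]
    exact pow_lt_pow_left₀ h1 h0 two_ne_zero
  have h8 : C * (p.Dbar ^ 2 * ‖evalAt p.Abar L‖ ^ 2) < C * s := by
    refine hfin.trans_lt ?_
    rw [mul_comm s C]
    exact mul_lt_of_lt_one_right (mul_pos hC0 hs0) hθ1
  exact lt_of_mul_lt_mul_left h8 hC0'

/-- If `C̄ = 0` the spectrum is identically `1` and the dual map is constant. Otherwise the weight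
is bounded below, and a large `s` makes the constraint active everywhere. -/
lemma exists_dualMap_le (hu : p.StabilizableU) (hγ : p.gammaInf < ENNReal.ofReal γ) :
    ∃ b, 0 ≤ b ∧ p.dualMap γ b ≤ b := by
  have hT := Tnc_lt hu hγ
  set C := ∑ i, p.Cbar i ^ 2 with hC
  have hC0' : 0 ≤ C := Finset.sum_nonneg fun i _ => sq_nonneg _
  rcases hC0'.eq_or_lt with h | h
  · have hw : ∀ s, p.spectrumOf γ s = fun _ => 1 := by
      intro s
      ext ω
      rw [spectrumOf, weight, ← hC, ← h]
      simp
    refine ⟨p.dualMap γ 0, mul_nonneg (sq_nonneg _) (sq_nonneg _), ?_⟩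
    simp only [dualMap, hw, le_refl]
  · have hγ2 : 0 < γ ^ 2 := (p.Tnc_nonneg 0).trans_lt (hT 0)
    -- The constant `4` comes from `|z - Ā| ≤ 2` on the unit circle.
    have hlow : ∀ ω, C / (4 * γ ^ 2) ≤ p.weight γ ω := by
      intro ω
      have h1 : 0 < ‖ejω ω - (p.Abar : ℂ)‖ :=
        norm_pos_iff.2 (ejω_sub_ne_zero (abs_Abar_lt_one hu) ω)
      have h2 : ‖ejω ω - (p.Abar : ℂ)‖ ≤ 2 := by
        refine (norm_sub_le _ _).trans ?_
        rw [norm_ejω, Complex.norm_real, Real.norm_eq_abs]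
        linarith [abs_Abar_lt_one hu]
      have h3 : 0 < γ ^ 2 - p.Tnc ω := sub_pos.2 (hT ω)
      rw [weight, ← hC, ← div_eq_mul_inv, div_div]
      refine div_le_div_of_nonneg_left hC0' (by positivity) ?_
      have h4 : ‖ejω ω - (p.Abar : ℂ)‖ ^ 2 ≤ 4 := by nlinarith
      exact mul_le_mul h4 (by linarith [p.Tnc_nonneg ω]) h3.le (by norm_num)
    refine ⟨4 * γ ^ 2 / C, by positivity, (dualMap_lt hu hγ (.of_forall fun ω => ?_)).le⟩
    have h5 : 4 * γ ^ 2 / C * (C / (4 * γ ^ 2)) = 1 := by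
      have : 4 * γ ^ 2 ≠ 0 := by positivity
      rw [div_mul_div_cancel₀ h.ne', div_self this]
    rw [← h5]
    exact mul_le_mul_of_nonneg_left (hlow ω) (by positivity)

lemma not_lt_of_dualMap_eq (hu : p.StabilizableU) (hγ : p.gammaInf < ENNReal.ofReal γ)
    {s t : ℝ} (hs : 0 ≤ s) (hs' : p.dualMap γ s = s)
    (ht' : p.dualMap γ t = t) : ¬ s < t := by
  intro hst
  have ht0 : 0 < t := hs.trans_lt hst
  have hD : p.Dbar ^ 2 ≠ 0 := fun h => by
    rw [dualMap, h, zero_mul] at ht'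
    exact ht0.ne ht'
  have hLs := exists_isSpectralFactor_spectrumOf hu hγ hs
  have hLt := exists_isSpectralFactor_spectrumOf hu hγ ht0.le
  -- Zero is a fixed point only if `D̄ = 0`, since a spectral factor has no zero at `Ā`; but `D̄ =
  -- 0` would force `t = 0`.
  have hs0 : 0 < s := by
    refine lt_of_le_of_ne hs fun h => ?_
    rw [← h, dualMap] at hs'
    have h1 := (mul_eq_zero.1 hs').resolve_left hD
    rw [← h] at hLs
    exact hLs.evalAt_ne_zero (abs_Abar_lt_one hu) (.of_forall (p.spectrumOf_pos γ 0))
      (norm_eq_zero.1 (pow_eq_zero_iff two_ne_zero |>.1 h1))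
  set q := t / s with hq
  have hq1 : 1 < q := (one_lt_div hs0).2 hst
  have hqs : q * s = t := div_mul_cancel₀ _ hs0.ne'
  have hle : ∀ ω, p.spectrumOf γ t ω ≤ q * p.spectrumOf γ s ω := by
    rw [← hqs]
    exact p.spectrumOf_mul_le γ s hq1.le
  -- Both fixed-point equations give `|L_t(Ā)|² = q |L_s(Ā)|²`, which is the equality case for `N_t
  -- ≤ q N_s`.
  have heq := hLt.ae_eq_of_norm_evalAt_le (abs_Abar_lt_one hu) (hLs.const_mul (by linarith))
    (.of_forall (p.spectrumOf_pos γ t)) (.of_forall hle) (by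
      refine (sq_le_sq₀ (norm_nonneg _) (norm_nonneg _)).1 ?_
      rw [norm_sqrt_mul_evalAt_sq (by linarith)]
      refine le_of_mul_le_mul_left ?_ (lt_of_le_of_ne (sq_nonneg p.Dbar) hD.symm)
      rw [mul_left_comm]
      change q * p.dualMap γ s ≤ p.dualMap γ t
      rw [hs', ht', hqs])
  -- From `N_t = q N_s ≥ q > 1` the constraint is active almost everywhere at `t`, so `t` cannot be
  -- fixed.
  refine (dualMap_lt hu hγ (s := t) ?_).ne ht'
  filter_upwards [heq] with ω hω
  by_contra hcon
  have h1 : p.spectrumOf γ t ω = 1 := max_eq_right (not_le.1 hcon).le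
  have h2 : 1 ≤ p.spectrumOf γ s ω := le_max_right _ _
  rw [h1] at hω
  nlinarith

lemma eq_of_dualMap_eq (hu : p.StabilizableU) (hγ : p.gammaInf < ENNReal.ofReal γ)
    {s t : ℝ} (hs : 0 ≤ s) (ht : 0 ≤ t) (hs' : p.dualMap γ s = s)
    (ht' : p.dualMap γ t = t) : s = t :=
  le_antisymm (not_lt.1 (not_lt_of_dualMap_eq hu hγ ht ht' hs'))
    (not_lt.1 (not_lt_of_dualMap_eq hu hγ hs hs' ht'))

end Plant

/-! ### Splitting off the strictly anticausal part. -/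

lemma StrictlyAnticausal.congr {f g : Freq → ℂ} (hf : StrictlyAnticausal f) (h : f =ᵐ[dω] g) :
    StrictlyAnticausal g := by
  intro n hn
  rw [← fourierCoeff_congr_ae h]
  exact hf n hn

lemma StrictlyAnticausal.const_mul {f : Freq → ℂ} (hf : StrictlyAnticausal f) (k : ℂ) :
    StrictlyAnticausal fun ω => k * f ω := by
  intro n hn
  rw [fourierCoeff.const_mul, hf n hn, mul_zero]

lemma StrictlyAnticausal.sum {ι : Type*} (s : Finset ι) {f : ι → Freq → ℂ}
    (hf : ∀ i ∈ s, StrictlyAnticausal (f i)) (hfi : ∀ i ∈ s, Integrable (f i) dω) :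
    StrictlyAnticausal fun ω => ∑ i ∈ s, f i ω := by
  intro n hn
  have := congrFun (fourierCoeff.sum s f hfi) n
  rw [Finset.sum_apply] at this
  rw [show (fun ω => ∑ i ∈ s, f i ω) = ∑ i ∈ s, f i by ext; simp, this]
  exact Finset.sum_eq_zero fun i hi => hf i hi n hn

/-- The strictly anticausal part of `k (z⁻¹ - c)⁻¹ f` for causal `f`. -/
lemma ae_eq_of_kernel_splitting {c : ℝ} (hc : |c| < 1) {S f g : Freq → ℂ} {k : ℂ}
    (hS : StrictlyAnticausal S) (hS2 : MemLp S 2 dω) (hf : Causal f) (hf2 : MemLp f 2 dω)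
    (hg : Causal g) (hg2 : MemLp g 2 dω)
    (h : ∀ᵐ ω ∂dω, S ω = k * ((ejω ω)⁻¹ - c)⁻¹ * f ω + g ω) :
    ∀ᵐ ω ∂dω, S ω = k * ((ejω ω)⁻¹ - c)⁻¹ * evalAt c f := by
  have hfi := hf2.integrable one_le_two
  have hq2 : MemLp (fun ω => ((ejω ω)⁻¹ - c)⁻¹ * (f ω - evalAt c f)) 2 dω :=
    memLp_continuous_mul (continuous_anticausal_kernel hc) (hf2.sub (memLp_const _))
  have hq := hf.quotient hc hfi
  have hker2 := memLp_of_continuous (continuous_anticausal_kernel hc) 2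
  have hker := strictlyAnticausal_kernel hc
  have hD2 : MemLp (fun ω => S ω + (-(k * evalAt c f)) * ((ejω ω)⁻¹ - c)⁻¹) 2 dω :=
    hS2.add (hker2.const_mul _)
  have hDa : StrictlyAnticausal fun ω => S ω + (-(k * evalAt c f)) * ((ejω ω)⁻¹ - c)⁻¹ := by
    intro n hn
    rw [fourierCoeff_fun_add (hS2.integrable one_le_two)
      ((hker2.const_mul _).integrable one_le_two), hS n hn, hker.const_mul _ n hn, add_zero]
  -- The difference of the two sides is `g` plus a multiple of the causal difference quotient of
  -- `f`; being strictly anticausal as well, it vanishes.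
  have hDc : Causal fun ω => S ω + (-(k * evalAt c f)) * ((ejω ω)⁻¹ - c)⁻¹ := by
    have h1 := (hq.const_mul k).add hg ((hq2.const_mul k).integrable one_le_two)
      (hg2.integrable one_le_two)
    refine h1.congr ?_
    filter_upwards [h] with ω hω
    rw [hω]
    ring
  filter_upwards [ae_eq_zero_of_causal_of_strictlyAnticausal hD2 hDc hDa] with ω hω
  simp only [Pi.zero_apply] at hω
  linear_combination hω

lemma sum_norm_sq_mulVec_of_unitary {m : ℕ} {U : Matrix (Fin m) (Fin m) ℂ} (hU : Uᴴ * U = 1)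
    (v : Fin m → ℂ) : ∑ i, ‖(U *ᵥ v) i‖ ^ 2 = ∑ i, ‖v i‖ ^ 2 := by
  have hsum : ∀ w : Fin m → ℂ, ((∑ i, ‖w i‖ ^ 2 : ℝ) : ℂ) = star w ⬝ᵥ w := by
    intro w
    simp [dotProduct, ← Complex.conj_mul']
  apply Complex.ofReal_injective
  rw [hsum, hsum, star_mulVec, ← dotProduct_mulVec, mulVec_mulVec, hU, one_mulVec]

namespace Plant

variable {m : ℕ} {p : Plant m} {γ : ℝ}

/-! ### The KKT condition -/

/-- The free parameter is chosen so that `Δ (K_∘ - K) = S L⁻¹` with `S = F₁ (D̄ L(Ā))`. Its causal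
part is a difference quotient of `L⁻¹`, which is in `H_∞` because `N ≥ 1` bounds `L⁻¹`. -/
lemma exists_isKKT (hu : p.StabilizableU) (hγ : p.gammaInf < ENNReal.ofReal γ) {s : ℝ}
    (hs : 0 ≤ s) (hfix : p.dualMap γ s = s) : ∃ K, p.IsKKT γ (p.spectrumOf γ s) K := by
  have hc := abs_Abar_lt_one hu
  have hL := exists_isSpectralFactor_spectrumOf hu hγ hs
  rw [dualMap] at hfix
  generalize spectralFactor (p.spectrumOf γ s) = L at hL hfix
  have hpos : ∀ᵐ ω ∂dω, 0 < p.spectrumOf γ s ω := .of_forall (p.spectrumOf_pos γ s)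
  have hL0 := hL.ae_ne_zero hpos
  have hLi : HInf fun ω => (L ω)⁻¹ := by
    refine ⟨memLp_top_of_bound hL.2.2.1.1 1 ?_, hL.2.2.2.1⟩
    filter_upwards [hL.2.2.2.2.1] with ω hω
    have h1 : 1 ≤ ‖L ω‖ ^ 2 := by rw [hω]; exact le_max_right _ _
    rw [norm_inv]
    exact inv_le_one_of_one_le₀ ((one_le_sq_iff₀ (norm_nonneg _)).1 h1)
  have hev : evalAt p.Abar L * evalAt p.Abar (fun ω => (L ω)⁻¹) = 1 := by
    rw [← evalAt_mul hc hL.2.1 hL.2.2.2.1 hL.1 hL.2.2.1, ← evalAt_const hc 1]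
    refine evalAt_congr ?_
    filter_upwards [hL0] with ω hω
    exact mul_inv_cancel₀ hω
  set e := evalAt p.Abar L with he
  have hqR : HInf fun ω =>
      ((ejω ω)⁻¹ - p.Abar)⁻¹ * ((L ω)⁻¹ - evalAt p.Abar fun ω => (L ω)⁻¹) :=
    ⟨memLp_continuous_mul (continuous_anticausal_kernel hc) (hLi.1.sub (memLp_const _)),
      hLi.2.quotient hc hLi.integrable⟩
  obtain ⟨K, hK, hKR⟩ := exists_admissible_of_param hu
    (R := fun ω i => (p.Cbar i * p.Dbar * e : ℂ) * (((ejω ω)⁻¹ - p.Abar)⁻¹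
      * ((L ω)⁻¹ - evalAt p.Abar fun ω => (L ω)⁻¹))) fun i => hqR.const_mul _
  have hker2 := memLp_of_continuous (continuous_anticausal_kernel hc) 2
  refine ⟨K, p.factor, L, p.F1 (p.Dbar * e), isPlantFactor_factor hu, hL, hK,
    fun i => ⟨?_, ?_⟩, ?_, ?_⟩
  · have h := hker2.const_mul (p.Cbar i * (p.Dbar * e) : ℂ)
    refine h.ae_eq (.of_forall fun ω => ?_)
    simp only [F1]
    ring
  · refine ((strictlyAnticausal_kernel hc).const_mul (p.Cbar i * (p.Dbar * e) : ℂ)).congr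
      (.of_forall fun ω => ?_)
    simp only [F1]
    ring
  · filter_upwards [hKR, hL0] with ω h1 h2
    rw [mulVec_sub] at h1
    have h3 := sub_eq_iff_eq_add.1 h1
    rw [h3, smul_add, add_comm]
    congr 1
    ext i
    simp only [Pi.smul_apply, Pi.add_apply, anticausalPart, F1, smul_eq_mul]
    have h4 := mul_inv_cancel₀ h2
    linear_combination (p.Cbar i * p.Dbar * e * ((ejω ω)⁻¹ - p.Abar)⁻¹) * h4
      - (p.Cbar i * p.Dbar * ((ejω ω)⁻¹ - p.Abar)⁻¹ * L ω) * hev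
  · refine .of_forall fun ω => ?_
    have h := congrFun (p.F2_F1 γ (p.Dbar * e)) ω
    rw [norm_mul, mul_pow, Complex.norm_real, Real.norm_eq_abs, sq_abs, hfix] at h
    exact h.symm

/-- A constant unitary matrix relates the given plant factor to the explicit one and does not change
`‖S‖`. The kernel splitting then identifies `S`, up to this matrix, with `F₁ (F₄ L)`, which closes
the fixed-point equation. -/
lemma IsKKT.exists_dualMap_eq {N : Freq → ℝ} {K : Freq → Fin m → ℂ} (h : p.IsKKT γ N K)
    (hu : p.StabilizableU) (hγ : p.gammaInf < ENNReal.ofReal γ) :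
    ∃ s, 0 ≤ s ∧ p.dualMap γ s = s ∧ N =ᵐ[dω] p.spectrumOf γ s := by
  have hc := abs_Abar_lt_one hu
  obtain ⟨Δ, L, S, hΔ, hL, hK, hS, hsplit, hN⟩ := h
  obtain ⟨R, hR, hKR⟩ := exists_param_of_admissible hu hK
  obtain ⟨U, hU, hΔU⟩ := hΔ.exists_unitary (isPlantFactor_factor hu)
  have hU' : Uᴴᴴ * Uᴴ = 1 := by
    rw [conjTranspose_conjTranspose]
    exact mul_eq_one_comm.1 hU
  have hT2 : ∀ i, MemLp (fun ω => (Uᴴ *ᵥ S ω) i) 2 dω := fun i => by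
    simp only [mulVec, dotProduct]
    exact memLp_finsetSum _ fun j _ => (hS j).1.const_mul (Uᴴ i j)
  have hTa : ∀ i, StrictlyAnticausal fun ω => (Uᴴ *ᵥ S ω) i := fun i => by
    simp only [mulVec, dotProduct]
    exact StrictlyAnticausal.sum _ (fun j _ => (hS j).2.const_mul (Uᴴ i j))
      fun j _ => ((hS j).1.const_mul (Uᴴ i j)).integrable one_le_two
  have hTeq : ∀ i, ∀ᵐ ω ∂dω, (Uᴴ *ᵥ S ω) i
      = (p.Cbar i * p.Dbar : ℂ) * ((ejω ω)⁻¹ - p.Abar)⁻¹ * L ω + R ω i * L ω := by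
    intro i
    filter_upwards [hsplit, hKR, hΔU] with ω h1 h2 h3
    have h4 : S ω = U *ᵥ (L ω • (p.anticausalPart ω + R ω)) := by
      rw [← h2, mulVec_smul, mulVec_mulVec, ← h3, mulVec_sub, smul_sub, h1, add_sub_cancel_left]
    rw [h4, mulVec_mulVec, hU, one_mulVec, Pi.smul_apply, Pi.add_apply, anticausalPart,
      smul_eq_mul]
    ring
  have hTF : ∀ i, ∀ᵐ ω ∂dω, (Uᴴ *ᵥ S ω) i = p.F1 (p.F4 L) ω i := by
    intro i
    have h1 := ae_eq_of_kernel_splitting hc (hTa i) (hT2 i) hL.2.1 hL.1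
      ((hR i).2.mul hL.2.1 ((hR i).memLp 2) hL.1) (hL.1.mul (hR i).1) (hTeq i)
    filter_upwards [h1] with ω hω
    rw [hω, F1, F4_eq]
    ring
  have hNs : N =ᵐ[dω] p.spectrumOf γ (‖p.F4 L‖ ^ 2) := by
    filter_upwards [hN, ae_all_iff.2 hTF] with ω h1 h2
    rw [h1, ← F2_F1, F2, ← sum_norm_sq_mulVec_of_unitary hU' (S ω)]
    simp only [h2]
  refine ⟨‖p.F4 L‖ ^ 2, sq_nonneg _, ?_, hNs⟩
  rw [dualMap_eq_of_isSpectralFactor hu hγ (sq_nonneg _) hNs hL, norm_F4_sq]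

/-! ### Optimality -/

lemma HInf.memLp_norm_sq {f : Freq → ℂ} (hf : HInf f) : MemLp (fun ω => ‖f ω‖ ^ 2) ∞ dω := by
  simp only [sq]
  exact hf.1.norm.mul hf.1.norm

lemma Admissible.memLp_norm_closedLoop_sq {K : Freq → Fin m → ℂ} (hK : p.Admissible K) :
    MemLp (fun ω => ‖p.closedLoop K ω‖ ^ 2) ∞ dω := by
  simp only [norm_closedLoop_sq]
  exact (HInf.memLp_norm_sq hK.2).add
    (memLp_finsetSum _ fun i _ => HInf.memLp_norm_sq (hK.1 i))

/-- For an unstable plant `Δ` need not be in `H_∞`. In the difference, `Δ = X + Y F` leaves only `K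
- K'` and the difference of the closed loops, where `G` cancels. -/
lemma IsPlantFactor.hInf_mulVec_sub {Δ : Freq → Matrix (Fin m) (Fin m) ℂ}
    (hΔ : p.IsPlantFactor Δ) {K K' : Freq → Fin m → ℂ} (hK : p.Admissible K)
    (hK' : p.Admissible K') (i : Fin m) : HInf fun ω => (Δ ω *ᵥ (K ω - K' ω)) i := by
  obtain ⟨X, Y, hX, hY, hXY⟩ := hΔ.2.2.2
  have h : HInf fun ω => ∑ j, X ω i j * (K ω j - K' ω j)
      + Y ω i * ((p.F ω ⬝ᵥ K ω + p.G ω) - (p.F ω ⬝ᵥ K' ω + p.G ω)) :=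
    (HInf.sum _ fun j _ => (hX i j).mul ((hK.1 j).sub (hK'.1 j))).add
      ((hY i).mul (hK.2.sub hK'.2))
  refine h.congr ?_
  filter_upwards [hXY] with ω hω
  rw [hω, add_mulVec, vecMulVec_mulVec, Pi.add_apply, Pi.smul_apply, MulOpposite.smul_eq_mul_unop,
    MulOpposite.unop_op, dotProduct_sub, add_sub_add_right_eq_sub]
  simp only [mulVec, dotProduct, Pi.sub_apply]

lemma IsKKT.isSaddlePoint {N : Freq → ℝ} {K : Freq → Fin m → ℂ} (h : p.IsKKT γ N K)
    (hT : ∀ ω, p.Tnc ω < γ ^ 2) : p.IsSaddlePoint γ K (fun ω => N ω - 1) := by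
  obtain ⟨Δ, L, S, hΔ, hL, hK, hS, hsplit, hN⟩ := h
  have hN1 : ∀ᵐ ω ∂dω, 1 ≤ N ω := by
    filter_upwards [hN] with ω hω
    rw [hω]
    exact le_max_right _ _
  have hNi : Integrable N dω :=
    (hL.1.integrable_norm_pow two_ne_zero).congr hL.2.2.2.2.1
  have hS' : ∀ᵐ ω ∂dω, L ω • (Δ ω *ᵥ (p.Knc ω - K ω)) = S ω := by
    filter_upwards [hsplit] with ω hω
    rw [mulVec_sub, smul_sub, hω, add_sub_cancel_left]
  refine ⟨hK, ⟨hNi.sub (integrable_const 1), ?_⟩, fun K' hK' => ?_, fun Λ hΛ => ?_⟩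
  · filter_upwards [hN1] with ω hω
    linarith
  · rw [lagrangian, lagrangian]
    simp only [add_sub_cancel]
    have hi : Integrable (fun ω => ‖p.closedLoop K ω‖ ^ 2 * N ω) dω :=
      hNi.mul_of_top_right hK.memLp_norm_closedLoop_sq
    have hi' : Integrable (fun ω => ‖p.closedLoop K' ω‖ ^ 2 * N ω) dω :=
      hNi.mul_of_top_right hK'.memLp_norm_closedLoop_sq
    have hE := hΔ.hInf_mulVec_sub hK hK'
    set W : Fin m → Freq → ℂ := fun i ω => L ω * (Δ ω *ᵥ (K ω - K' ω)) i with hW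
    have hWc : ∀ i, Causal (W i) := fun i => hL.2.1.mul (hE i).2 hL.1 ((hE i).memLp 2)
    have hW2 : ∀ i, MemLp (W i) 2 dω := fun i => (hE i).1.mul hL.1
    have hcr : ∀ i, Integrable (fun ω => conj (S ω i) * W i ω) dω := fun i =>
      (hS i).1.star.integrable_mul (hW2 i)
    have hzero : ∀ i, ∫ ω, (conj (S ω i) * W i ω).re ∂dω = 0 := by
      intro i
      have h1 := integral_re (𝕜 := ℂ) (hcr i)
      rw [integral_conj_mul_eq_zero (hS i).2 (hWc i) (hS i).1 (hW2 i)] at h1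
      simpa using h1
    have hre : ∀ i, Integrable (fun ω => (conj (S ω i) * W i ω).re) dω := fun i => (hcr i).re
    -- Completing the square replaces `S` by `S + W` when `K` is replaced by `K'`; the nonnegative
    -- `‖W‖²` is dropped and the cross term integrates to zero.
    have hle : ∀ᵐ ω ∂dω, ‖p.closedLoop K ω‖ ^ 2 * N ω
        + 2 * ∑ i, (conj (S ω i) * W i ω).re ≤ ‖p.closedLoop K' ω‖ ^ 2 * N ω := by
      filter_upwards [hΔ.1, hS', hL.2.2.2.2.1] with ω h1 h2 h3
      have hX : ∀ v : Fin m → ℂ, (∑ i, ‖v i‖ ^ 2) * N ω = ∑ i, ‖(L ω • v) i‖ ^ 2 := by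
        intro v
        rw [← h3, Finset.sum_mul]
        refine Finset.sum_congr rfl fun i _ => ?_
        rw [Pi.smul_apply, smul_eq_mul, norm_mul, mul_pow, mul_comm]
      have h4 : L ω • (Δ ω *ᵥ (p.Knc ω - K' ω)) = S ω + fun i => W i ω := by
        rw [← sub_add_sub_cancel (p.Knc ω) (K ω) (K' ω), mulVec_add, smul_add, h2]
        rfl
      rw [norm_closedLoop_sq_eq p K ω h1, norm_closedLoop_sq_eq p K' ω h1, add_mul, add_mul, hX, hX,
        h2, h4, Finset.mul_sum]
      have h5 : ∀ i, ‖S ω i‖ ^ 2 + 2 * (conj (S ω i) * W i ω).re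
          ≤ ‖(S ω + fun i => W i ω) i‖ ^ 2 := by
        intro i
        have h6 : ‖S ω i + W i ω‖ ^ 2
            = ‖S ω i‖ ^ 2 + 2 * (conj (S ω i) * W i ω).re + ‖W i ω‖ ^ 2 := by
          simp only [← Complex.normSq_eq_norm_sq, Complex.normSq_apply, Complex.add_re,
            Complex.add_im, Complex.mul_re, Complex.conj_re, Complex.conj_im]
          ring
        rw [Pi.add_apply, h6]
        linarith [sq_nonneg ‖W i ω‖]
      have h7 := Finset.sum_le_sum fun i (_ : i ∈ Finset.univ) => h5 i
      rw [Finset.sum_add_distrib] at h7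
      linarith
    have hsi : Integrable (fun ω => 2 * ∑ i, (conj (S ω i) * W i ω).re) dω :=
      (integrable_finsetSum _ fun i _ => hre i).const_mul 2
    have h8 := integral_mono_ae (hi.add hsi) hi' hle
    have h9 : ∫ ω, 2 * ∑ i, (conj (S ω i) * W i ω).re ∂dω = 0 := by
      rw [integral_const_mul, integral_finsetSum _ fun i _ => hre i,
        Finset.sum_eq_zero fun i _ => hzero i, mul_zero]
    simp only [Pi.add_apply] at h8
    rw [integral_add hi hsi, h9, add_zero] at h8
    linarith
  · have hb := hK.memLp_norm_closedLoop_sq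
    have hbi : Integrable (fun ω => ‖p.closedLoop K ω‖ ^ 2) dω := hb.integrable le_top
    have hsplitΛ : ∀ Λ : Freq → ℝ, Integrable Λ dω → p.lagrangian γ K Λ
        = ∫ ω, ‖p.closedLoop K ω‖ ^ 2 ∂dω
          + ∫ ω, (‖p.closedLoop K ω‖ ^ 2 - γ ^ 2) * Λ ω ∂dω := by
      intro Λ hΛi
      have h1 : Integrable (fun ω => ‖p.closedLoop K ω‖ ^ 2 * Λ ω) dω := hΛi.mul_of_top_right hb
      rw [lagrangian]
      simp only [mul_add, mul_one, sub_mul]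
      rw [integral_add hbi h1, integral_sub h1 (hΛi.const_mul _), integral_const_mul]
      ring
    -- Primal feasibility and complementary slackness, read off from the maximum in the KKT
    -- condition: where `N > 1`, the first entry attains it and `‖T_K‖ = γ`.
    have hval : ∀ᵐ ω ∂dω, ‖p.closedLoop K ω‖ ^ 2 - γ ^ 2 ≤ 0 ∧
        (‖p.closedLoop K ω‖ ^ 2 - γ ^ 2) * (N ω - 1) = 0 := by
      filter_upwards [hΔ.1, hS', hL.2.2.2.2.1, hN, hN1] with ω h1 h2 h3 h4 h5
      have h6 := norm_closedLoop_sq_eq p K ω h1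
      have hg : 0 < γ ^ 2 - p.Tnc ω := sub_pos.2 (hT ω)
      have h7 : ∑ i, ‖S ω i‖ ^ 2
          = N ω * ∑ i, ‖(Δ ω *ᵥ (p.Knc ω - K ω)) i‖ ^ 2 := by
        rw [← h2, ← h3, Finset.mul_sum]
        refine Finset.sum_congr rfl fun i _ => ?_
        rw [Pi.smul_apply, smul_eq_mul, norm_mul, mul_pow]
      rw [h7] at h4
      generalize ∑ i, ‖(Δ ω *ᵥ (p.Knc ω - K ω)) i‖ ^ 2 = q at *
      have h8 : N ω * q ≤ N ω * (γ ^ 2 - p.Tnc ω) := by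
        rw [← div_le_iff₀ hg]
        exact (le_max_left _ _).trans h4.ge
      have h9 : q ≤ γ ^ 2 - p.Tnc ω := le_of_mul_le_mul_left h8 (by linarith)
      refine ⟨by linarith, ?_⟩
      rcases h5.eq_or_lt with h10 | h10
      · rw [← h10, sub_self, mul_zero]
      · have h11 : N ω = N ω * q / (γ ^ 2 - p.Tnc ω) := by
          rcases max_choice (N ω * q / (γ ^ 2 - p.Tnc ω)) 1 with h12 | h12
          · rwa [h12] at h4
          · rw [h12] at h4
            exact absurd h4 h10.ne'
        rw [eq_div_iff hg.ne'] at h11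
        have h13 := mul_left_cancel₀ (by linarith : N ω ≠ 0) h11
        rw [h6, ← h13]
        ring
    rw [hsplitΛ Λ hΛ.1, hsplitΛ (fun ω => N ω - 1) (hNi.sub (integrable_const 1))]
    have h1 : ∫ ω, (‖p.closedLoop K ω‖ ^ 2 - γ ^ 2) * Λ ω ∂dω ≤ 0 := by
      refine integral_nonpos_of_ae ?_
      filter_upwards [hval, hΛ.2] with ω a b
      exact mul_nonpos_of_nonpos_of_nonneg a.1 b
    have h2 : ∫ ω, (‖p.closedLoop K ω‖ ^ 2 - γ ^ 2) * (N ω - 1) ∂dω = 0 := by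
      refine integral_eq_zero_of_ae ?_
      filter_upwards [hval] with ω a
      exact a.2
    rw [h2]
    linarith

/-! ### Convergence -/

lemma Niter_eq (p : Plant m) (γ : ℝ) (n : ℕ) :
    p.Niter γ n = p.spectrumOf γ (‖p.Biter γ n‖ ^ 2) := F2_F1 _ _ _

/-- The weight is bounded by the gap between `γ²` and `T_{K_∘}* T_{K_∘}`, so `s ↦ spectrumOf γ s` is
Lipschitz uniformly in the frequency. -/
lemma tendstoUniformly_spectrumOf (hu : p.StabilizableU) (hγ : p.gammaInf < ENNReal.ofReal γ)
    {x : ℕ → ℝ} {s : ℝ} (hx : Tendsto x atTop (𝓝 s)) :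
    TendstoUniformly (fun n => p.spectrumOf γ (x n)) (p.spectrumOf γ s) atTop := by
  obtain ⟨W, hW⟩ := exists_weight_le hu hγ
  have hw := weight_nonneg (Tnc_lt hu hγ)
  rw [Metric.tendstoUniformly_iff]
  intro ε hε
  have hlim : Tendsto (fun n => |s - x n| * W) atTop (𝓝 0) := by
    have h1 := ((tendsto_const_nhds (x := s)).sub hx).abs.mul_const W
    simpa using h1
  filter_upwards [hlim.eventually (gt_mem_nhds hε)] with n hn ω
  rw [Real.dist_eq]
  refine lt_of_le_of_lt ?_ hn
  refine (abs_max_sub_max_le_abs _ _ _).trans ?_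
  rw [← sub_mul, abs_mul, abs_of_nonneg (hw ω)]
  exact mul_le_mul_of_nonneg_left (hW ω) (abs_nonneg _)

end Plant

end MixedControl

end

open MixedControl MixedControl.Plant in
theorem theorem5 {m : ℕ} (p : MixedControl.Plant m)
    (hu : p.StabilizableU) (hw : p.StabilizableW)
    (γ : ℝ) (hγ : p.gammaInf < ENNReal.ofReal γ) :
    (∀ n, MixedControl.IsSpectralFactor (p.Niter γ n)
      (MixedControl.spectralFactor (p.Niter γ n))) ∧
    (∀ ω, Monotone fun n => p.Niter γ n ω) ∧
    ∃ (N : MixedControl.Freq → ℝ) (K : MixedControl.Freq → Fin m → ℂ),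
      TendstoUniformly (p.Niter γ) N atTop ∧
      p.IsKKT γ N K ∧
      (∀ N' K', p.IsKKT γ N' K' → N' =ᵐ[MixedControl.dω] N) ∧
      p.IsSaddlePoint γ K (fun ω => N ω - 1) := by
  have hT := Tnc_lt hu hγ
  obtain ⟨b, hb, hΦb⟩ := exists_dualMap_le hu hγ
  obtain ⟨hmono, hnn, s, hs, hfix, hlim⟩ := tendsto_iterate_of_subhomogeneous
    (Φ := p.dualMap γ) (x := fun n => ‖p.Biter γ n‖ ^ 2)
    (fun s => mul_nonneg (sq_nonneg _) (sq_nonneg _)) (fun s t h0 h => dualMap_mono hu hγ h0 h)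
    (fun s t h0 h => dualMap_mul_le hu hγ h0 h) hb hΦb (by simp [Biter])
    (norm_Biter_succ_sq p γ)
  obtain ⟨K, hK⟩ := exists_isKKT hu hγ hs hfix
  refine ⟨fun n => ?_, fun ω n k hnk => ?_, p.spectrumOf γ s, K, ?_, hK, fun N' K' h' => ?_,
    hK.isSaddlePoint hT⟩
  · rw [Niter_eq]
    exact exists_isSpectralFactor_spectrumOf hu hγ (hnn n)
  · simp only [Niter_eq]
    exact max_le_max (mul_le_mul_of_nonneg_right (hmono hnk) (weight_nonneg hT ω)) le_rfl
  · rw [show p.Niter γ = fun n => p.spectrumOf γ (‖p.Biter γ n‖ ^ 2) from funext (Niter_eq p γ)]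
    exact tendstoUniformly_spectrumOf hu hγ hlim
  · obtain ⟨t, ht, htfix, hN'⟩ := h'.exists_dualMap_eq hu hγ
    rwa [eq_of_dualMap_eq hu hγ ht hs htfix hfix] at hN'
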